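/- Let $q$ be an odd prime power and let $PG(3,q)$ be the projective space whose points, lines and planes are the vector subspaces of $\mathbb{F}_q^4$ of dimension $1$, $2$ and $3$. Let $\mathcal{S}$ be a set of lines of $PG(3,q)$ with the following properties. (P1) Every point of $PG(3,q)$ lies on $q(q+1)/2$ or on $q^2$ lines of $\mathcal{S}$; further, there exist a point which lies on exactly $q(q+1)/2$ lines of $\mathcal{S}$ and a point which lies on exactly $q^2$ lines of $\mathcal{S}$. (P2) Every plane $\pi$ of $PG(3,q)$ contains $q(q+1)/2$ or $q^2$ lines of $\mathcal{S}$. Further, (P2a) if $\pi$ contains $q^2$ lines of $\mathcal{S}$, then every pencil of lines in $\pi$ (that is, the set of all lines of $\pi$ through a given point of $\pi$) contains $0$ or $q$ lines of $\mathcal{S}$; (P2b) if $\pi$ contains $q(q+1)/2$ lines of $\mathcal{S}$, then every pencil of lines in $\pi$ contains $(q-1)/2$, $(q+1)/2$ or $q$ lines of $\mathcal{S}$. Then either $\mathcal{S}$ is the set of all secant lines of a hyperbolic quadric in $PG(3,q)$ (that is, of all lines meeting in exactly two points some non-degenerate quadric of Witt index two), or the points lying on $q^2$ lines of $\mathcal{S}$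 are exactly the points of a line $l$ of $PG(3,q)$ with $l\notin\mathcal{S}$, and $|\mathcal{S}|=\dfrac{q^4+q^3+2q^2}{2}$. -/

import Mathlib

open Module
open scoped LinearAlgebra.Projectivization

namespace PG3

/-- The vector space underlying `PG(3,q)`, where `q = |K|`. -/
abbrev Vec (K : Type*) := Fin 4 → K

/-- Points of `PG(3,q)`. -/
abbrev Point (K : Type*) [Field K] := ℙ K (Vec K)

/-- Lines of `PG(3,q)`: the two-dimensional vector subspaces of `K⁴`. -/
abbrev Line (K : Type*) [Field K] := {l : Submodule K (Vec K) // finrank K l = 2}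

/-- Planes of `PG(3,q)`: the three-dimensional vector subspaces of `K⁴`. -/
abbrev Plane (K : Type*) [Field K] := {π : Submodule K (Vec K) // finrank K π = 3}

variable {K : Type*} [Field K]

/-- The point `x` lies on the line `l`. -/
def PointOnLine (x : Point K) (l : Line K) : Prop := x.submodule ≤ l.1

/-- The point `x` lies in the plane `π`. -/
def PointInPlane (x : Point K) (π : Plane K) : Prop := x.submodule ≤ π.1

/-- The line `l` is contained in the plane `π`. -/
def LineInPlane (l : Line K) (π : Plane K) : Prop := l.1 ≤ π.1

/-- The lines through the point `x`. -/
def linesThrough (x : Point K) : Set (Line K) := {l | PointOnLine x l}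

/-- The lines contained in the plane `π`. -/
def linesIn (π : Plane K) : Set (Line K) := {l | LineInPlane l π}

/-- The pencil of lines of the plane `π` with vertex `x` (used for points `x` of `π`). -/
def pencil (x : Point K) (π : Plane K) : Set (Line K) := linesThrough x ∩ linesIn π

/-- The points of the quadric with equation `Q = 0`. -/
def quadricPoints (Q : QuadraticForm K (Vec K)) : Set (Point K) :=
  {x | ∀ v ∈ x.submodule, Q v = 0}

/-- `Q = 0` is a hyperbolic quadric of `PG(3,q)`: it is non-degenerate, and its Witt index, the
largest (vector space) dimension of a totally singular subspace, is two. -/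
def IsHyperbolic (Q : QuadraticForm K (Vec K)) : Prop :=
  Q.polarBilin.Nondegenerate ∧
    IsGreatest {d : ℕ | ∃ W : Submodule K (Vec K), (∀ w ∈ W, Q w = 0) ∧ finrank K W = d} 2

/-- The lines that meet the point set `X` in exactly two points. -/
def secantLines (X : Set (Point K)) : Set (Line K) :=
  {l | {x | x ∈ X ∧ PointOnLine x l}.ncard = 2}

end PG3

/-!
Write `q = |K|`.  A point is *black* if it is on `q ^ 2` lines of `S` (and *white* otherwise), a
plane is *tangent* if it contains `q ^ 2` lines of `S` (and *secant* otherwise).  The theorem is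
obtained by counting, up to the last step, where a quadric is written down.

Two facts about a projective plane of order `q` do the local work.  A set of `q ^ 2` lines with at
most `q` through each point is the set of lines avoiding some point
(`IsProjPlane.exists_center`).  A set of `q (q + 1) / 2` lines with `(q - 1) / 2`, `(q + 1) / 2` or
`q` through each point looks like the secants of an oval: a line of the set has two points on `q`
lines of the set, and any other line has at most one (`IsProjPlane.card_full_points`).  Both are
applied in planes and, dually, to the lines and planes through a point.

The first fact gives every tangent plane a point of it such that the lines of the plane in `S` are
those avoiding that point, and gives every black point a tangent plane whose lines through the
point are the lines through the point that are outside `S`.  Black points and tangent planes are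
equally many, so this is a bijection, polarity (`IsPole`, `IsSecantFamily.exists_pole`).  Counting
flags around a line with the second fact shows that any line `l` is on as many tangent planes as
black points (`blackCard_eq_tangentCard`), and that this number is `q + 1`, in which case `l ∉ S`,
or at most `2`, and then at most `1` if `l ∉ S` (`blackCard_cases`, `not_mem_of_blackCard_eq`).

Let `B` be the number of black points.  Summing over the lines through a white point on `t` tangent
planes yields `B = t (q + 1)`; summing over the lines through a black point on `m` lines of black
points yields `B + q ^ 2 + q = (1 + q m) (q + 1)`.  Also `m ≤ 2`, since a line of the polar plane
avoiding the pole is in `S` and meets all those `m` lines.  Hence either `m = 1` and `B = q + 1`, so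
that the black points are those of one line, or `m = 2` everywhere and `B = (q + 1) ^ 2`
(`card_black_cases`).  In the second case a count shows that `S` consists of the lines with exactly
two black points, and any three black lines meeting a fourth are skew and have the set of black
points as the union of their transversals; this union is a hyperbolic quadric, `x₀ x₃ = x₁ x₂` in
suitable coordinates (`exists_hyperbolic_of_skew`).
-/

namespace PG3

/-! ### Line sets in finite projective planes -/

section Planar

open Finset

theorem sum_card_filter_comm {α β : Type*} (s : Finset α) (t : Finset β) (r : α → β → Prop)
    [∀ a b, Decidable (r a b)] :
    ∑ a ∈ s, #{b ∈ t | r a b} = ∑ b ∈ t, #{a ∈ s | r a b} :=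
  Finset.sum_card_bipartiteAbove_eq_sum_card_bipartiteBelow r

open scoped Classical

/-- The point set `A` and the line set `M`, with incidence relation `I`, form a finite projective
plane of order `q`.  Working with finsets of ambient types lets the same lemmas serve the points
and lines of a plane of `PG(3,q)` and the planes and lines through a point of `PG(3,q)`. -/
structure IsProjPlane {P L : Type*} (I : P → L → Prop) (A : Finset P) (M : Finset L) (q : ℕ) :
    Prop where
  card_points : #A = q ^ 2 + q + 1
  card_lines : #M = q ^ 2 + q + 1
  lines_through : ∀ x ∈ A, #{l ∈ M | I x l} = q + 1
  points_on : ∀ l ∈ M, #{x ∈ A | I x l} = q + 1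
  meet : ∀ l ∈ M, ∀ m ∈ M, l ≠ m → #{x ∈ A | I x l ∧ I x m} = 1

namespace IsProjPlane

variable {P L : Type*} {I : P → L → Prop} {A : Finset P} {M T : Finset L} {q : ℕ}

theorem sum_card_through (h : IsProjPlane I A M q) (hT : T ⊆ M) :
    ∑ x ∈ A, #{l ∈ T | I x l} = #T * (q + 1) := by
  rw [sum_card_filter_comm, Finset.sum_congr rfl fun l hl => h.points_on l (hT hl)]
  simp

theorem sum_card_through_on (h : IsProjPlane I A M q) (hT : T ⊆ M) {l : L} (hl : l ∈ M) :
    ∑ x ∈ A with I x l, #{m ∈ T | I x m} = #T + if l ∈ T then q else 0 := by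
  rw [sum_card_filter_comm]
  have key : ∀ m ∈ T, #{x ∈ A.filter (I · l) | I x m} = 1 + if l = m then q else 0 := by
    intro m hm
    rw [Finset.filter_filter]
    split_ifs with hlm
    · subst hlm
      simp only [and_self]
      rw [h.points_on l hl, add_comm]
    · exact h.meet l hl m (hT hm) hlm
  rw [Finset.sum_congr rfl key, Finset.sum_add_distrib]
  simp

theorem sum_mul_card_through (g : P → ℤ) :
    ∑ l ∈ T, ∑ x ∈ A with I x l, g x = ∑ x ∈ A, g x * (#{l ∈ T | I x l} : ℤ) := by
  simp only [Finset.sum_filter]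
  rw [Finset.sum_comm]
  refine Finset.sum_congr rfl fun x _ => ?_
  rw [← Finset.sum_filter, Finset.sum_const, nsmul_eq_mul, mul_comm]

/-- A set of `q ^ 2` lines of a projective plane of order `q`, at most `q` of them through any
point, consists of all lines avoiding some point.  This is the dual of the fact that a blocking set
of `q + 1` points is a line: the numbers `c x` of lines through `x` outside the set satisfy
`1 ≤ c x ≤ q + 1` and `∑ (c x - 1) * (q + 1 - c x) = 0`. -/
theorem exists_center (h : IsProjPlane I A M q) (hq : 0 < q) (hT : T ⊆ M) (hc : #T = q ^ 2)
    (hle : ∀ x ∈ A, #{l ∈ T | I x l} ≤ q) : ∃ p ∈ A, ∀ l ∈ M, l ∈ T ↔ ¬ I p l := by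
  have hR : M \ T ⊆ M := Finset.sdiff_subset
  have hRc : #(M \ T) = q + 1 := by
    have := Finset.card_sdiff_add_card_eq_card hT
    rw [hc, h.card_lines] at this
    omega
  have hsplit : ∀ x ∈ A, #{l ∈ M \ T | I x l} + #{l ∈ T | I x l} = q + 1 := by
    intro x hx
    rw [← h.lines_through x hx, ← Finset.card_union_of_disjoint, ← Finset.filter_union,
      Finset.sdiff_union_of_subset hT]
    exact Finset.disjoint_filter_filter Finset.sdiff_disjoint
  have h1 : ∑ x ∈ A, (#{l ∈ M \ T | I x l} : ℤ) = (q + 1) * (q + 1) := by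
    have := h.sum_card_through hR
    rw [hRc] at this
    exact_mod_cast this
  have h2 : ∑ x ∈ A, (#{l ∈ M \ T | I x l} : ℤ) * #{l ∈ M \ T | I x l}
      = (q + 1) * (2 * q + 1) := by
    rw [← sum_mul_card_through]
    have : ∀ l ∈ M \ T, ∑ x ∈ A with I x l, (#{m ∈ M \ T | I x m} : ℤ) = 2 * q + 1 := by
      intro l hl
      have := h.sum_card_through_on hR (hR hl)
      rw [if_pos hl, hRc] at this
      rw [← Nat.cast_sum, this]
      push_cast; ring
    rw [Finset.sum_congr rfl this, Finset.sum_const, hRc]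
    simp
  have h3 : ∑ x ∈ A, ((#{l ∈ M \ T | I x l} : ℤ) - 1) * (q + 1 - #{l ∈ M \ T | I x l}) = 0 := by
    have : ∀ x ∈ A, ((#{l ∈ M \ T | I x l} : ℤ) - 1) * (q + 1 - #{l ∈ M \ T | I x l})
        = (q + 2) * (#{l ∈ M \ T | I x l} : ℤ)
          - (#{l ∈ M \ T | I x l} : ℤ) * #{l ∈ M \ T | I x l} - (q + 1) := fun x _ => by ring
    rw [Finset.sum_congr rfl this, Finset.sum_sub_distrib, Finset.sum_sub_distrib, ← Finset.mul_sum,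
      h1, h2, Finset.sum_const, h.card_points]
    simp only [nsmul_eq_mul]
    push_cast
    ring
  have h4 : ∀ x ∈ A, ((#{l ∈ M \ T | I x l} : ℤ) - 1) * (q + 1 - #{l ∈ M \ T | I x l}) = 0 := by
    refine (Finset.sum_eq_zero_iff_of_nonneg fun x hx => ?_).1 h3
    have a := hsplit x hx
    have b := hle x hx
    apply mul_nonneg <;> omega
  obtain ⟨p, hp, hpc⟩ : ∃ p ∈ A, #{l ∈ M \ T | I p l} = q + 1 := by
    by_contra! hne
    have : ∀ x ∈ A, (#{l ∈ M \ T | I x l} : ℤ) = 1 := by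
      intro x hx
      have a := hne x hx
      rcases mul_eq_zero.1 (h4 x hx) with b | b <;> omega
    rw [Finset.sum_congr rfl this, Finset.sum_const, h.card_points] at h1
    simp only [nsmul_eq_mul] at h1
    push_cast at h1
    have : (0 : ℤ) < q := by exact_mod_cast hq
    nlinarith
  refine ⟨p, hp, fun l hl => ⟨fun hlT hI => ?_, fun hI => ?_⟩⟩
  · have := hsplit p hp
    have hpos : 0 < #{l ∈ T | I p l} := Finset.card_pos.2 ⟨l, by simp [hlT, hI]⟩
    omega
  · by_contra hlT
    have hall := Finset.filter_card_eq (hpc.trans hRc.symm)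
    exact hI (hall l (by simp [hl, hlT]))

/-- If every point of a projective plane of order `q` is on `(q-1)/2`, `(q+1)/2` or `q` lines
of a set `T` of `q(q+1)/2` lines, then the points on `q` lines of `T` behave like an oval with `T`
as its set of secants: they are two on each line of `T` and at most one on any other line.

For `w x = 2 * #(lines of T through x) - q`, which is `-1`, `1` or `q`, the sum over the points of
a line is `2 * q` or `0` according to whether the line is in `T`; this gives the upper bounds, and
counting incidences shows that all of them are attained on `T`. -/
theorem card_full_points (h : IsProjPlane I A M q) (hq : 2 ≤ q) (hT : T ⊆ M)
    (hc : 2 * #T = q * (q + 1))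
    (hf : ∀ x ∈ A, 2 * #{l ∈ T | I x l} + 1 = q ∨ 2 * #{l ∈ T | I x l} = q + 1 ∨
      #{l ∈ T | I x l} = q) :
    (∀ l ∈ T, #{x ∈ A | I x l ∧ #{m ∈ T | I x m} = q} = 2) ∧
      ∀ l ∈ M, l ∉ T → #{x ∈ A | I x l ∧ #{m ∈ T | I x m} = q} ≤ 1 := by
  have hq' : (2 : ℤ) ≤ q := by exact_mod_cast hq
  have hc' : (2 : ℤ) * #T = q * (q + 1) := by exact_mod_cast hc
  have hline : ∀ l ∈ M, ∑ x ∈ A with I x l, (2 * (#{m ∈ T | I x m} : ℤ) - q)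
      = if l ∈ T then 2 * (q : ℤ) else 0 := by
    intro l hl
    have := h.sum_card_through_on hT hl
    rw [Finset.sum_sub_distrib, ← Finset.mul_sum, ← Nat.cast_sum, this, Finset.sum_const,
      h.points_on l hl]
    split_ifs <;> simp only [nsmul_eq_mul] <;> push_cast <;> linarith
  have hlow : ∀ l ∈ M, ((q : ℤ) + 1) * #{x ∈ A | I x l ∧ #{m ∈ T | I x m} = q} - (q + 1)
      ≤ ∑ x ∈ A with I x l, (2 * (#{m ∈ T | I x m} : ℤ) - q) := by
    intro l hl
    have : ((q : ℤ) + 1) * #{x ∈ A | I x l ∧ #{m ∈ T | I x m} = q} - (q + 1)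
        = ∑ x ∈ A with I x l, ((q + 1) * (if #{m ∈ T | I x m} = q then (1 : ℤ) else 0) - 1) := by
      rw [Finset.sum_sub_distrib, ← Finset.mul_sum, Finset.sum_boole, Finset.filter_filter,
        Finset.sum_const, h.points_on l hl]
      simp
    rw [this]
    refine Finset.sum_le_sum fun x hx => ?_
    have := hf x (Finset.mem_filter.1 hx).1
    split_ifs with hxq
    · rw [hxq]; linarith
    · omega
  have hle : ∀ l ∈ T, #{x ∈ A | I x l ∧ #{m ∈ T | I x m} = q} ≤ 2 := by
    intro l hl
    have a := hlow l (hT hl)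
    rw [hline l (hT hl), if_pos hl] at a
    by_contra! hlt
    have : (3 : ℤ) ≤ #{x ∈ A | I x l ∧ #{m ∈ T | I x m} = q} := by exact_mod_cast hlt
    nlinarith
  have hcard : #{x ∈ A | #{m ∈ T | I x m} = q} = q + 1 := by
    have h1 : ∑ x ∈ A, (2 * (#{m ∈ T | I x m} : ℤ) - q) = q ^ 2 := by
      have := h.sum_card_through hT
      rw [Finset.sum_sub_distrib, ← Finset.mul_sum, ← Nat.cast_sum, this, Finset.sum_const,
        h.card_points]
      simp only [nsmul_eq_mul]
      push_cast
      linear_combination ((q : ℤ) + 1) * hc'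
    have h2 : ∑ x ∈ A, (2 * (#{m ∈ T | I x m} : ℤ) - q) * #{m ∈ T | I x m}
        = q ^ 2 * (q + 1) := by
      rw [← sum_mul_card_through, Finset.sum_congr rfl fun l hl =>
        (hline l (hT hl)).trans (if_pos hl), Finset.sum_const]
      simp only [nsmul_eq_mul]
      linear_combination (q : ℤ) * hc'
    have h3 : ∑ x ∈ A, (2 * (#{m ∈ T | I x m} : ℤ) - q) ^ 2
        = ∑ x ∈ A, (1 + ((q : ℤ) ^ 2 - 1) * if #{m ∈ T | I x m} = q then (1 : ℤ) else 0) := by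
      refine Finset.sum_congr rfl fun x hx => ?_
      split_ifs with hxq
      · rw [hxq]; ring
      · rcases hf x hx with a | a | a
        · have : (2 * (#{m ∈ T | I x m} : ℤ) - q) = -1 := by omega
          rw [this]; ring
        · have : (2 * (#{m ∈ T | I x m} : ℤ) - q) = 1 := by omega
          rw [this]; ring
        · exact absurd a hxq
    have h4 : ∑ x ∈ A, (2 * (#{m ∈ T | I x m} : ℤ) - q) ^ 2
        = 2 * ∑ x ∈ A, (2 * (#{m ∈ T | I x m} : ℤ) - q) * #{m ∈ T | I x m}
          - q * ∑ x ∈ A, (2 * (#{m ∈ T | I x m} : ℤ) - q) := by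
      rw [Finset.mul_sum, Finset.mul_sum, ← Finset.sum_sub_distrib]
      exact Finset.sum_congr rfl fun x _ => by ring
    rw [h1, h2, h3, Finset.sum_add_distrib, ← Finset.mul_sum, Finset.sum_boole, Finset.sum_const,
      h.card_points] at h4
    simp only [nsmul_eq_mul, mul_one] at h4
    push_cast at h4
    have h5 : ((q : ℤ) ^ 2 - 1) * (#{x ∈ A | #{m ∈ T | I x m} = q} - (q + 1)) = 0 := by
      linear_combination h4
    rcases mul_eq_zero.1 h5 with h6 | h6
    · nlinarith
    · omega
  refine ⟨?_, fun l hl hlT => ?_⟩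
  · have hsum : ∑ l ∈ T, #{x ∈ A | I x l ∧ #{m ∈ T | I x m} = q} = ∑ l ∈ T, 2 := by
      have h1 : ∀ l ∈ T, #{x ∈ A | I x l ∧ #{m ∈ T | I x m} = q}
          = #{x ∈ A.filter (fun x => #{m ∈ T | I x m} = q) | I x l} := fun l _ => by
        rw [Finset.filter_filter]
        simp only [and_comm]
      rw [Finset.sum_congr rfl h1, ← sum_card_filter_comm,
        Finset.sum_congr rfl fun x hx => (Finset.mem_filter.1 hx).2, Finset.sum_const, hcard,
        Finset.sum_const, smul_eq_mul, smul_eq_mul]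
      linarith
    exact (Finset.sum_eq_sum_iff_of_le hle).1 hsum
  · have a := hlow l hl
    rw [hline l hl, if_neg hlT] at a
    by_contra! hlt
    have : (2 : ℤ) ≤ #{x ∈ A | I x l ∧ #{m ∈ T | I x m} = q} := by exact_mod_cast hlt
    nlinarith

end IsProjPlane

end Planar

/-! ### Incidences of points, lines and planes -/

section Geometry

variable {K : Type*} [Field K]

theorem finrank_point (x : Point K) : finrank K x.submodule = 1 := x.finrank_submodule

theorem exists_point {U : Submodule K (Vec K)} (h : finrank K U = 1) :
    ∃ x : Point K, x.submodule = U :=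
  ⟨Projectivization.mk'' U h, Projectivization.submodule_mk'' U h⟩

theorem exists_point_le {U : Submodule K (Vec K)} (h : U ≠ ⊥) :
    ∃ x : Point K, x.submodule ≤ U := by
  obtain ⟨v, hv, hv0⟩ := Submodule.exists_mem_ne_zero_of_ne_bot h
  refine ⟨Projectivization.mk K v hv0, ?_⟩
  rwa [Projectivization.submodule_mk, Submodule.span_singleton_le_iff_mem]

theorem finrank_vec : finrank K (Vec K) = 4 := by simp

/-- The line through two distinct points. -/
theorem exists_line {x y : Point K} (h : x ≠ y) :
    ∃ l : Line K, l.1 = x.submodule ⊔ y.submodule := by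
  refine ⟨⟨x.submodule ⊔ y.submodule, ?_⟩, rfl⟩
  have h1 := Submodule.finrank_sup_add_finrank_inf_eq x.submodule y.submodule
  rw [finrank_point, finrank_point] at h1
  have h2 : finrank K (x.submodule ⊓ y.submodule : Submodule K (Vec K)) ≠ 1 := by
    intro h2
    have a := Submodule.eq_of_le_of_finrank_eq inf_le_left (h2.trans (finrank_point x).symm)
    have b := Submodule.eq_of_le_of_finrank_eq inf_le_right (h2.trans (finrank_point y).symm)
    exact h (Projectivization.submodule_injective (a.symm.trans b))
  have h3 := Submodule.finrank_mono (inf_le_left : x.submodule ⊓ y.submodule ≤ x.submodule)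
  rw [finrank_point] at h3
  omega

theorem line_eq_sup {x y : Point K} (h : x ≠ y) {l : Line K} (hx : PointOnLine x l)
    (hy : PointOnLine y l) : l.1 = x.submodule ⊔ y.submodule := by
  obtain ⟨m, hm⟩ := exists_line h
  rw [← hm]
  refine (Submodule.eq_of_le_of_finrank_eq ?_ (m.2.trans l.2.symm)).symm
  rw [hm]
  exact sup_le hx hy

theorem line_unique {x y : Point K} (h : x ≠ y) {l m : Line K} (hxl : PointOnLine x l)
    (hyl : PointOnLine y l) (hxm : PointOnLine x m) (hym : PointOnLine y m) : l = m :=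
  Subtype.ext ((line_eq_sup h hxl hyl).trans (line_eq_sup h hxm hym).symm)

theorem exists_line_through {x y : Point K} (h : x ≠ y) :
    ∃ l : Line K, PointOnLine x l ∧ PointOnLine y l := by
  obtain ⟨l, hl⟩ := exists_line h
  exact ⟨l, le_sup_left.trans hl.ge, le_sup_right.trans hl.ge⟩

theorem lineInPlane_of_ne {x y : Point K} (h : x ≠ y) {l : Line K} (hx : PointOnLine x l)
    (hy : PointOnLine y l) {π : Plane K} (hxπ : PointInPlane x π) (hyπ : PointInPlane y π) :
    LineInPlane l π := by
  rw [LineInPlane, line_eq_sup h hx hy]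
  exact sup_le hxπ hyπ

theorem PointOnLine.inPlane {x : Point K} {l : Line K} {π : Plane K} (h : PointOnLine x l)
    (h' : LineInPlane l π) : PointInPlane x π := le_trans h h'

theorem finrank_inf_line {l m : Line K} (h : l ≠ m) :
    finrank K (l.1 ⊓ m.1 : Submodule K (Vec K)) ≤ 1 := by
  have h3 := Submodule.finrank_mono (inf_le_left : l.1 ⊓ m.1 ≤ l.1)
  rw [l.2] at h3
  by_contra! h4
  have h5 : finrank K (l.1 ⊓ m.1 : Submodule K (Vec K)) = 2 := by omega
  exact h (Subtype.ext (
    (Submodule.eq_of_le_of_finrank_eq inf_le_left (h5.trans l.2.symm)).symm.trans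
    (Submodule.eq_of_le_of_finrank_eq inf_le_right (h5.trans m.2.symm))))

theorem exists_meet {l m : Line K} (h : l ≠ m) {π : Plane K} (hl : LineInPlane l π)
    (hm : LineInPlane m π) : ∃ x : Point K, PointOnLine x l ∧ PointOnLine x m := by
  have h1 := Submodule.finrank_sup_add_finrank_inf_eq l.1 m.1
  have h2 := Submodule.finrank_mono (sup_le hl hm)
  rw [l.2, m.2] at h1
  rw [π.2] at h2
  have h3 := finrank_inf_line h
  obtain ⟨x, hx⟩ := exists_point (U := l.1 ⊓ m.1) (by omega)
  exact ⟨x, hx.le.trans inf_le_left, hx.le.trans inf_le_right⟩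

theorem exists_join {l m : Line K} (h : l ≠ m) {x : Point K} (hl : PointOnLine x l)
    (hm : PointOnLine x m) : ∃ π : Plane K, π.1 = l.1 ⊔ m.1 := by
  refine ⟨⟨l.1 ⊔ m.1, ?_⟩, rfl⟩
  have h1 := Submodule.finrank_sup_add_finrank_inf_eq l.1 m.1
  have h2 := Submodule.finrank_mono (le_inf hl hm)
  rw [l.2, m.2] at h1
  rw [finrank_point] at h2
  have h3 := finrank_inf_line h
  omega

theorem plane_unique {l m : Line K} (h : l ≠ m) {x : Point K} (hl : PointOnLine x l)
    (hm : PointOnLine x m) {π π' : Plane K} (h1 : LineInPlane l π) (h2 : LineInPlane m π)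
    (h3 : LineInPlane l π') (h4 : LineInPlane m π') : π = π' := by
  obtain ⟨σ, hσ⟩ := exists_join h hl hm
  have e1 := Submodule.eq_of_le_of_finrank_eq (hσ.le.trans (sup_le h1 h2)) (σ.2.trans π.2.symm)
  have e2 := Submodule.eq_of_le_of_finrank_eq (hσ.le.trans (sup_le h3 h4)) (σ.2.trans π'.2.symm)
  exact Subtype.ext (e1.symm.trans e2)

theorem exists_plane {x : Point K} {l : Line K} (h : ¬ PointOnLine x l) :
    ∃ π : Plane K, PointInPlane x π ∧ LineInPlane l π := by
  have hx : x.rep ∉ l.1 := by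
    rwa [PointOnLine, Projectivization.submodule_eq, Submodule.span_singleton_le_iff_mem] at h
  refine ⟨⟨l.1 ⊔ K ∙ x.rep, ?_⟩, ?_, le_sup_left⟩
  · rw [Submodule.finrank_sup_span_singleton hx, l.2]
  · rw [PointInPlane, Projectivization.submodule_eq]
    exact le_sup_right

theorem exists_meet_plane (l : Line K) (π : Plane K) :
    ∃ x : Point K, PointOnLine x l ∧ PointInPlane x π := by
  have h1 := Submodule.finrank_sup_add_finrank_inf_eq l.1 π.1
  have h2 := Submodule.finrank_le (l.1 ⊔ π.1)
  rw [l.2, π.2] at h1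
  rw [finrank_vec] at h2
  obtain ⟨x, hx⟩ := exists_point_le (U := l.1 ⊓ π.1) fun h => by
    rw [h, finrank_bot] at h1
    omega
  exact ⟨x, hx.trans inf_le_left, hx.trans inf_le_right⟩

end Geometry

/-! ### Counting subspaces -/

section Counting

open Finset
open scoped Classical

variable {K : Type*} [Field K] [Fintype K]

section Covers

variable {V : Type*} [AddCommGroup V] [Module K V] [Fintype V]

theorem card_mem_not_mem {U W : Submodule K V} (h : U ≤ W) :
    #{v : V | v ∈ W ∧ v ∉ U} + Fintype.card K ^ finrank K U = Fintype.card K ^ finrank K W := by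
  rw [← Module.card_eq_pow_finrank (K := K) (V := U),
    ← Module.card_eq_pow_finrank (K := K) (V := W),
    Fintype.card_subtype, Fintype.card_subtype, ← Finset.card_union_of_disjoint]
  · congr 1
    ext v
    simp only [mem_union, mem_filter, mem_univ, true_and]
    have := @h v
    tauto
  · rw [Finset.disjoint_filter]
    tauto

/-- The number of subspaces between `W` and `W'` covering `W` is `(q ^ d - 1) / (q - 1)`, where `d`
is the codimension of `W` in `W'`: such subspaces partition the vectors of `W'` outside `W`. -/
theorem card_covers {W W' : Submodule K V} (hW : W ≤ W') {d : ℕ}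
    (hd : finrank K W' = finrank K W + d) {F : Finset (Submodule K V)}
    (hF : ∀ U, U ∈ F ↔ W ≤ U ∧ U ≤ W' ∧ finrank K U = finrank K W + 1) :
    #F * (Fintype.card K - 1) + 1 = Fintype.card K ^ d := by
  have hq : 1 < Fintype.card K := Fintype.one_lt_card
  have h1 : ∀ U ∈ F, #{v ∈ ({v : V | v ∈ W' ∧ v ∉ W} : Finset V) | v ∈ U}
      = Fintype.card K ^ finrank K W * (Fintype.card K - 1) := by
    intro U hU
    obtain ⟨a, b, c⟩ := (hF U).1 hU
    have := card_mem_not_mem a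
    rw [c, pow_succ] at this
    rw [Finset.filter_filter, Nat.mul_sub, mul_one, ← this, Nat.add_sub_cancel]
    congr 1
    ext v
    simp only [mem_filter, mem_univ, true_and]
    have := @b v
    tauto
  have h2 : ∀ v ∈ ({v : V | v ∈ W' ∧ v ∉ W} : Finset V), #{U ∈ F | v ∈ U} = 1 := by
    intro v hv
    simp only [mem_filter, mem_univ, true_and] at hv
    rw [Finset.card_eq_one]
    refine ⟨W ⊔ K ∙ v, ?_⟩
    have hr := Submodule.finrank_sup_span_singleton hv.2
    ext U
    simp only [mem_filter, mem_singleton, hF]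
    constructor
    · rintro ⟨⟨a, b, c⟩, d⟩
      refine (Submodule.eq_of_le_of_finrank_eq (sup_le a ?_) (hr.trans c.symm)).symm
      rwa [Submodule.span_singleton_le_iff_mem]
    · rintro rfl
      refine ⟨⟨le_sup_left, sup_le hW ?_, hr⟩, ?_⟩
      · rw [Submodule.span_singleton_le_iff_mem]; exact hv.1
      · exact Submodule.mem_sup_right (Submodule.mem_span_singleton_self v)
  have h3 := sum_card_filter_comm F ({v : V | v ∈ W' ∧ v ∉ W} : Finset V) (fun U v => v ∈ U)
  rw [Finset.sum_congr rfl h1, Finset.sum_congr rfl h2, Finset.sum_const, Finset.sum_const,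
    smul_eq_mul, smul_eq_mul, mul_one] at h3
  have h4 := card_mem_not_mem hW
  rw [← h3, hd, pow_add] at h4
  have h5 : 0 < Fintype.card K ^ finrank K W := by positivity
  refine Nat.eq_of_mul_eq_mul_left h5 ?_
  rw [← h4]; ring

theorem card_covers_two {W W' : Submodule K V} (hW : W ≤ W')
    (hd : finrank K W' = finrank K W + 2) {F : Finset (Submodule K V)}
    (hF : ∀ U, U ∈ F ↔ W ≤ U ∧ U ≤ W' ∧ finrank K U = finrank K W + 1) :
    #F = Fintype.card K + 1 := by
  have hq : 1 < Fintype.card K := Fintype.one_lt_card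
  have := card_covers hW hd hF
  obtain ⟨r, hr⟩ := Nat.exists_eq_add_of_lt hq
  rw [hr] at this ⊢
  simp only [show 1 + r + 1 - 1 = r + 1 by omega] at this
  refine Nat.eq_of_mul_eq_mul_right (Nat.succ_pos r) ?_
  linarith

theorem card_covers_three {W W' : Submodule K V} (hW : W ≤ W')
    (hd : finrank K W' = finrank K W + 3) {F : Finset (Submodule K V)}
    (hF : ∀ U, U ∈ F ↔ W ≤ U ∧ U ≤ W' ∧ finrank K U = finrank K W + 1) :
    #F = Fintype.card K ^ 2 + Fintype.card K + 1 := by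
  have hq : 1 < Fintype.card K := Fintype.one_lt_card
  have := card_covers hW hd hF
  obtain ⟨r, hr⟩ := Nat.exists_eq_add_of_lt hq
  rw [hr] at this ⊢
  simp only [show 1 + r + 1 - 1 = r + 1 by omega] at this
  refine Nat.eq_of_mul_eq_mul_right (Nat.succ_pos r) ?_
  linarith

end Covers

noncomputable instance : Fintype (Point K) := Fintype.ofFinite _

noncomputable instance : Fintype (Line K) := Fintype.ofFinite _

noncomputable instance : Fintype (Plane K) := Fintype.ofFinite _

theorem card_points_on (l : Line K) : #{x : Point K | PointOnLine x l} = Fintype.card K + 1 := by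
  rw [← Finset.card_image_of_injective _ (Projectivization.submodule_injective (K := K))]
  refine card_covers_two (W := ⊥) (W' := l.1) bot_le (by simp [l.2]) fun U => ?_
  simp only [mem_image, mem_filter, mem_univ, true_and, bot_le, finrank_bot, zero_add]
  constructor
  · rintro ⟨x, hx, rfl⟩
    exact ⟨hx, finrank_point x⟩
  · rintro ⟨hU, h1⟩
    obtain ⟨x, rfl⟩ := exists_point h1
    exact ⟨x, hU, rfl⟩

theorem card_points_in (π : Plane K) :
    #{x : Point K | PointInPlane x π} = Fintype.card K ^ 2 + Fintype.card K + 1 := by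
  rw [← Finset.card_image_of_injective _ (Projectivization.submodule_injective (K := K))]
  refine card_covers_three (W := ⊥) (W' := π.1) bot_le (by simp [π.2]) fun U => ?_
  simp only [mem_image, mem_filter, mem_univ, true_and, bot_le, finrank_bot, zero_add]
  constructor
  · rintro ⟨x, hx, rfl⟩
    exact ⟨hx, finrank_point x⟩
  · rintro ⟨hU, h1⟩
    obtain ⟨x, rfl⟩ := exists_point h1
    exact ⟨x, hU, rfl⟩

theorem card_pencil {x : Point K} {π : Plane K} (h : PointInPlane x π) :
    #{l : Line K | PointOnLine x l ∧ LineInPlane l π} = Fintype.card K + 1 := by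
  rw [← Finset.card_image_of_injective _ Subtype.val_injective]
  refine card_covers_two (W := x.submodule) (W' := π.1) h (by rw [π.2, finrank_point]) fun U => ?_
  simp only [mem_image, mem_filter, mem_univ, true_and, finrank_point]
  constructor
  · rintro ⟨l, hl, rfl⟩
    exact ⟨hl.1, hl.2, l.2⟩
  · rintro ⟨h1, h2, h3⟩
    exact ⟨⟨U, h3⟩, ⟨h1, h2⟩, rfl⟩

theorem card_lines_through (x : Point K) :
    #{l : Line K | PointOnLine x l} = Fintype.card K ^ 2 + Fintype.card K + 1 := by
  rw [← Finset.card_image_of_injective _ Subtype.val_injective]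
  refine card_covers_three (W := x.submodule) (W' := ⊤) le_top
    (by rw [finrank_top, finrank_point, finrank_vec]) fun U => ?_
  simp only [mem_image, mem_filter, mem_univ, true_and, finrank_point, le_top]
  constructor
  · rintro ⟨l, hl, rfl⟩
    exact ⟨hl, l.2⟩
  · rintro ⟨h1, h3⟩
    exact ⟨⟨U, h3⟩, h1, rfl⟩

theorem card_planes_on (l : Line K) : #{π : Plane K | LineInPlane l π} = Fintype.card K + 1 := by
  rw [← Finset.card_image_of_injective _ Subtype.val_injective]
  refine card_covers_two (W := l.1) (W' := ⊤) le_top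
    (by rw [finrank_top, l.2, finrank_vec]) fun U => ?_
  simp only [mem_image, mem_filter, mem_univ, true_and, l.2, le_top]
  constructor
  · rintro ⟨π, hl, rfl⟩
    exact ⟨hl, π.2⟩
  · rintro ⟨h1, h3⟩
    exact ⟨⟨U, h3⟩, h1, rfl⟩

theorem card_points : Fintype.card (Point K) =
    (Fintype.card K + 1) * (Fintype.card K ^ 2 + 1) := by
  have hq : 1 < Fintype.card K := Fintype.one_lt_card
  have := card_covers (K := K) (W := ⊥) (W' := (⊤ : Submodule K (Vec K))) (d := 4) bot_le (by simp)
    (F := univ.image fun x : Point K => x.submodule) (fun U => by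
      simp only [mem_image, mem_univ, true_and, bot_le, finrank_bot, zero_add, le_top]
      constructor
      · rintro ⟨x, rfl⟩
        exact finrank_point x
      · exact exists_point)
  rw [Finset.card_image_of_injective _ (Projectivization.submodule_injective (K := K)),
    Finset.card_univ] at this
  obtain ⟨r, hr⟩ := Nat.exists_eq_add_of_lt hq
  rw [hr] at this ⊢
  simp only [show 1 + r + 1 - 1 = r + 1 by omega] at this
  refine Nat.eq_of_mul_eq_mul_right (Nat.succ_pos r) ?_
  linarith

theorem isProjPlane_plane (π : Plane K) :
    IsProjPlane PointOnLine ({x | PointInPlane x π} : Finset (Point K))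
      ({l | LineInPlane l π} : Finset (Line K)) (Fintype.card K) := by
  have h1 : ∀ x ∈ ({x | PointInPlane x π} : Finset (Point K)),
      #{l ∈ ({l | LineInPlane l π} : Finset (Line K)) | PointOnLine x l} = Fintype.card K + 1 := by
    intro x hx
    rw [← card_pencil (mem_filter.1 hx).2, Finset.filter_filter]
    simp only [and_comm]
  have h2 : ∀ l ∈ ({l | LineInPlane l π} : Finset (Line K)),
      #{x ∈ ({x | PointInPlane x π} : Finset (Point K)) | PointOnLine x l}
        = Fintype.card K + 1 := by
    intro l hl
    rw [← card_points_on l, Finset.filter_filter]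
    congr 1
    ext x
    simp only [mem_filter, mem_univ, true_and, and_iff_right_iff_imp]
    exact fun h => h.inPlane (mem_filter.1 hl).2
  refine ⟨card_points_in π, ?_, h1, h2, fun l hl m hm hlm => ?_⟩
  · have h3 := sum_card_filter_comm ({x | PointInPlane x π} : Finset (Point K))
      ({l | LineInPlane l π} : Finset (Line K)) PointOnLine
    rw [Finset.sum_congr rfl h1, Finset.sum_congr rfl h2, Finset.sum_const, Finset.sum_const,
      card_points_in] at h3
    exact (Nat.eq_of_mul_eq_mul_right (Nat.succ_pos _) h3).symm
  · simp only [mem_filter, mem_univ, true_and] at hl hm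
    obtain ⟨x, hxl, hxm⟩ := exists_meet hlm hl hm
    rw [Finset.card_eq_one]
    refine ⟨x, ?_⟩
    ext y
    simp only [mem_filter, mem_univ, true_and, mem_singleton]
    constructor
    · rintro ⟨-, hyl, hym⟩
      by_contra hne
      exact hlm (line_unique hne hyl hxl hym hxm)
    · rintro rfl
      exact ⟨hxl.inPlane hl, hxl, hxm⟩

theorem isProjPlane_point (x : Point K) :
    IsProjPlane (fun π l => LineInPlane l π) ({π | PointInPlane x π} : Finset (Plane K))
      ({l | PointOnLine x l} : Finset (Line K)) (Fintype.card K) := by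
  have h1 : ∀ π ∈ ({π | PointInPlane x π} : Finset (Plane K)),
      #{l ∈ ({l | PointOnLine x l} : Finset (Line K)) | LineInPlane l π} = Fintype.card K + 1 := by
    intro π hπ
    rw [← card_pencil (mem_filter.1 hπ).2, Finset.filter_filter]
  have h2 : ∀ l ∈ ({l | PointOnLine x l} : Finset (Line K)),
      #{π ∈ ({π | PointInPlane x π} : Finset (Plane K)) | LineInPlane l π}
        = Fintype.card K + 1 := by
    intro l hl
    rw [← card_planes_on l, Finset.filter_filter]
    congr 1
    ext π
    simp only [mem_filter, mem_univ, true_and, and_iff_right_iff_imp]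
    exact fun h => PointOnLine.inPlane (mem_filter.1 hl).2 h
  refine ⟨?_, card_lines_through x, h1, h2, fun l hl m hm hlm => ?_⟩
  · have h3 := sum_card_filter_comm ({π | PointInPlane x π} : Finset (Plane K))
      ({l | PointOnLine x l} : Finset (Line K)) (fun π l => LineInPlane l π)
    rw [Finset.sum_congr rfl h1, Finset.sum_congr rfl h2, Finset.sum_const, Finset.sum_const,
      card_lines_through] at h3
    exact Nat.eq_of_mul_eq_mul_right (Nat.succ_pos _) h3
  · simp only [mem_filter, mem_univ, true_and] at hl hm
    obtain ⟨π, hπ⟩ := exists_join hlm hl hm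
    have hlπ : LineInPlane l π := le_sup_left.trans hπ.ge
    have hmπ : LineInPlane m π := le_sup_right.trans hπ.ge
    rw [Finset.card_eq_one]
    refine ⟨π, ?_⟩
    ext σ
    simp only [mem_filter, mem_univ, true_and, mem_singleton]
    constructor
    · rintro ⟨-, hlσ, hmσ⟩
      exact plane_unique hlm hl hm hlσ hmσ hlπ hmπ
    · rintro rfl
      exact ⟨hl.inPlane hlπ, hlπ, hmπ⟩

theorem card_lines_in (π : Plane K) :
    #{l : Line K | LineInPlane l π} = Fintype.card K ^ 2 + Fintype.card K + 1 :=
  (isProjPlane_plane π).card_lines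

theorem card_planes : Fintype.card (Plane K) = Fintype.card (Point K) := by
  have h1 := sum_card_filter_comm (univ : Finset (Point K)) (univ : Finset (Line K)) PointOnLine
  have h2 := sum_card_filter_comm (univ : Finset (Plane K)) (univ : Finset (Line K))
    (fun π l => LineInPlane l π)
  simp only [card_points_on, card_lines_through, card_planes_on, card_lines_in, Finset.sum_const,
    Finset.card_univ, smul_eq_mul] at h1 h2
  exact Nat.eq_of_mul_eq_mul_right (Nat.succ_pos _) (h2.trans h1.symm)

end Counting
/-! ### Black points and tangent planes -/

section Chain

open Finset
open scoped Classical

variable {K : Type*} [Field K] [Fintype K]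

/-- The hypotheses of the characterization, for a finset of lines and with the halves cleared by
means of the parity of `q`. -/
structure IsSecantFamily (S : Finset (Line K)) (q : ℕ) : Prop where
  card_field : Fintype.card K = q
  three_le : 3 ≤ q
  point : ∀ x : Point K, 2 * #{l ∈ S | PointOnLine x l} = q * (q + 1) ∨
    #{l ∈ S | PointOnLine x l} = q ^ 2
  exists_white : ∃ x : Point K, 2 * #{l ∈ S | PointOnLine x l} = q * (q + 1)
  exists_black : ∃ x : Point K, #{l ∈ S | PointOnLine x l} = q ^ 2
  plane : ∀ π : Plane K, 2 * #{l ∈ S | LineInPlane l π} = q * (q + 1) ∨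
    #{l ∈ S | LineInPlane l π} = q ^ 2
  pencil_tangent : ∀ π : Plane K, #{l ∈ S | LineInPlane l π} = q ^ 2 → ∀ x, PointInPlane x π →
    #{l ∈ S | PointOnLine x l ∧ LineInPlane l π} = 0 ∨
      #{l ∈ S | PointOnLine x l ∧ LineInPlane l π} = q
  pencil_secant : ∀ π : Plane K, 2 * #{l ∈ S | LineInPlane l π} = q * (q + 1) →
    ∀ x, PointInPlane x π →
    2 * #{l ∈ S | PointOnLine x l ∧ LineInPlane l π} + 1 = q ∨
      2 * #{l ∈ S | PointOnLine x l ∧ LineInPlane l π} = q + 1 ∨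
        #{l ∈ S | PointOnLine x l ∧ LineInPlane l π} = q

/-- The number of lines of `S` in the pencil with vertex `x` in the plane `π`. -/
noncomputable def pencilCard (S : Finset (Line K)) (x : Point K) (π : Plane K) : ℕ :=
  #{l ∈ S | PointOnLine x l ∧ LineInPlane l π}

/-- A point is black if it lies on `q ^ 2` lines of `S`; the other points are called white. -/
def Black (S : Finset (Line K)) (x : Point K) : Prop :=
  #{l ∈ S | PointOnLine x l} = Fintype.card K ^ 2

/-- A plane is tangent if it contains `q ^ 2` lines of `S`; the other planes are called secant. -/
def Tangent (S : Finset (Line K)) (π : Plane K) : Prop :=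
  #{l ∈ S | LineInPlane l π} = Fintype.card K ^ 2

/-- The point `x` is the pole of the plane `π`: it lies in `π`, and among the lines which pass
through `x` or lie in `π`, those outside `S` are the ones which do both. -/
structure IsPole (S : Finset (Line K)) (x : Point K) (π : Plane K) : Prop where
  mem : PointInPlane x π
  through : ∀ l, PointOnLine x l → (l ∈ S ↔ ¬ LineInPlane l π)
  inside : ∀ l, LineInPlane l π → (l ∈ S ↔ ¬ PointOnLine x l)

/-- The number of black points on a line. -/
noncomputable def blackCard (S : Finset (Line K)) (l : Line K) : ℕ :=
  #{x : Point K | PointOnLine x l ∧ Black S x}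

/-- The number of tangent planes containing a line. -/
noncomputable def tangentCard (S : Finset (Line K)) (l : Line K) : ℕ :=
  #{π : Plane K | LineInPlane l π ∧ Tangent S π}

theorem filter_plane_pencil {K : Type*} [Field K] (S : Finset (Line K)) (x : Point K)
    (π : Plane K) :
    #{l ∈ S.filter (LineInPlane · π) | PointOnLine x l} = pencilCard S x π := by
  rw [Finset.filter_filter, pencilCard]
  simp only [and_comm]

theorem filter_point_pencil {K : Type*} [Field K] (S : Finset (Line K)) (x : Point K)
    (π : Plane K) :
    #{l ∈ S.filter (PointOnLine x ·) | LineInPlane l π} = pencilCard S x π := by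
  rw [Finset.filter_filter, pencilCard]

theorem exists_line_avoiding {x p : Point K} {π : Plane K} (hx : PointInPlane x π) (h : x ≠ p) :
    ∃ l : Line K, PointOnLine x l ∧ LineInPlane l π ∧ ¬ PointOnLine p l := by
  by_contra! hc
  have h1 := card_pencil hx
  have h2 : #{l : Line K | PointOnLine x l ∧ LineInPlane l π} ≤ 1 := by
    refine Finset.card_le_one.2 fun l hl m hm => ?_
    simp only [mem_filter, mem_univ, true_and] at hl hm
    exact line_unique h hl.1 (hc l hl.1 hl.2) hm.1 (hc m hm.1 hm.2)
  have h3 : 0 < Fintype.card K := Fintype.card_pos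
  omega

theorem exists_line_not_in {x : Point K} {π σ : Plane K} (hx : PointInPlane x π) (h : π ≠ σ) :
    ∃ l : Line K, PointOnLine x l ∧ LineInPlane l π ∧ ¬ LineInPlane l σ := by
  by_contra! hc
  have h1 := card_pencil hx
  have h2 : #{l : Line K | PointOnLine x l ∧ LineInPlane l π} ≤ 1 := by
    refine Finset.card_le_one.2 fun l hl m hm => ?_
    simp only [mem_filter, mem_univ, true_and] at hl hm
    by_contra hlm
    exact h (plane_unique hlm hl.1 hm.1 hl.2 hm.2 (hc l hl.1 hl.2) (hc m hm.1 hm.2))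
  have h3 : 0 < Fintype.card K := Fintype.card_pos
  omega

variable {S : Finset (Line K)} {q : ℕ}

theorem IsPole.point_unique {x y : Point K} {π : Plane K} (hx : IsPole S x π) (hy : IsPole S y π) :
    x = y := by
  by_contra h
  obtain ⟨l, h1, h2, h3⟩ := exists_line_avoiding hx.mem h
  exact (hx.inside l h2).1 ((hy.inside l h2).2 h3) h1

theorem IsPole.plane_unique {x : Point K} {π σ : Plane K} (hx : IsPole S x π)
    (hy : IsPole S x σ) : π = σ := by
  by_contra h
  obtain ⟨l, h1, h2, h3⟩ := exists_line_not_in hx.mem h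
  exact (hx.through l h1).1 ((hy.through l h1).2 h3) h2

theorem pencilCard_add (S : Finset (Line K)) {x : Point K} {π : Plane K} (h : PointInPlane x π) :
    pencilCard S x π + #{l : Line K | l ∉ S ∧ PointOnLine x l ∧ LineInPlane l π}
      = Fintype.card K + 1 := by
  rw [← card_pencil h, pencilCard, ← Finset.card_union_of_disjoint]
  · congr 1
    ext l
    simp only [mem_union, mem_filter, mem_univ, true_and]
    tauto
  · rw [Finset.disjoint_left]
    intro l
    simp only [mem_filter, mem_univ, true_and]
    tauto

namespace IsSecantFamily

theorem pencilCard_le (h : IsSecantFamily S q) {x : Point K} {π : Plane K}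
    (hx : PointInPlane x π) : pencilCard S x π ≤ q := by
  unfold pencilCard
  rcases h.plane π with hπ | hπ
  · have := h.pencil_secant π hπ x hx
    omega
  · have := h.pencil_tangent π hπ x hx
    omega

theorem white_iff (h : IsSecantFamily S q) {x : Point K} :
    2 * #{l ∈ S | PointOnLine x l} = q * (q + 1) ↔ ¬ Black S x := by
  have h3 := h.three_le
  rw [Black, h.card_field]
  constructor
  · intro h1 h2
    rw [h2] at h1
    nlinarith
  · exact (h.point x).resolve_right

theorem secant_iff (h : IsSecantFamily S q) {π : Plane K} :
    2 * #{l ∈ S | LineInPlane l π} = q * (q + 1) ↔ ¬ Tangent S π := by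
  have h3 := h.three_le
  rw [Tangent, h.card_field]
  constructor
  · intro h1 h2
    rw [h2] at h1
    nlinarith
  · exact (h.plane π).resolve_right

theorem exists_center_of_tangent (h : IsSecantFamily S q) {π : Plane K} (hπ : Tangent S π) :
    ∃ p, PointInPlane p π ∧ ∀ l, LineInPlane l π → (l ∈ S ↔ ¬ PointOnLine p l) := by
  have h3 := h.three_le
  obtain ⟨p, hp, hp'⟩ := (isProjPlane_plane π).exists_center (T := S.filter (LineInPlane · π))
    (by rw [h.card_field]; omega)
    (fun l hl => by simpa using (mem_filter.1 hl).2) hπ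
    (fun x hx => by
      rw [filter_plane_pencil, h.card_field]
      exact h.pencilCard_le (by simpa using hx))
  refine ⟨p, by simpa using hp, fun l hl => ?_⟩
  have := hp' l (by simpa using hl)
  rw [← this, mem_filter, and_iff_left hl]

theorem exists_axis_of_black (h : IsSecantFamily S q) {x : Point K} (hx : Black S x) :
    ∃ π, PointInPlane x π ∧ ∀ l, PointOnLine x l → (l ∈ S ↔ ¬ LineInPlane l π) := by
  have h3 := h.three_le
  obtain ⟨π, hπ, hπ'⟩ := (isProjPlane_point x).exists_center (T := S.filter (PointOnLine x ·))
    (by rw [h.card_field]; omega)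
    (fun l hl => by simpa using (mem_filter.1 hl).2) hx
    (fun π hπ => by
      rw [filter_point_pencil, h.card_field]
      exact h.pencilCard_le (by simpa using hπ))
  refine ⟨π, by simpa using hπ, fun l hl => ?_⟩
  have := hπ' l (by simpa using hl)
  rw [← this, mem_filter, and_iff_left hl]

theorem exists_polar (h : IsSecantFamily S q) {x : Point K} (hx : Black S x) :
    ∃ π, Tangent S π ∧ IsPole S x π := by
  have h3 := h.three_le
  obtain ⟨π, hxπ, hπ⟩ := h.exists_axis_of_black hx
  have hf : #{l ∈ S | PointOnLine x l ∧ LineInPlane l π} = 0 := by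
    rw [Finset.card_eq_zero, Finset.filter_eq_empty_iff]
    rintro l hl ⟨h1, h2⟩
    exact (hπ l h1).1 hl h2
  have ht : Tangent S π := by
    by_contra ht
    have := h.pencil_secant π (h.secant_iff.2 ht) x hxπ
    omega
  obtain ⟨p, hpπ, hp⟩ := h.exists_center_of_tangent ht
  have hxp : x = p := by
    by_contra hne
    obtain ⟨l, h1, h2, h3⟩ := exists_line_avoiding hxπ hne
    exact (hπ l h1).1 ((hp l h2).2 h3) h2
  subst hxp
  exact ⟨π, ht, hxπ, hπ, hp⟩

theorem card_mul_eq_black (h : IsSecantFamily S q) :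
    2 * #S * (q + 1) = #{x : Point K | Black S x} * (q ^ 2 - q)
      + (q + 1) * (q ^ 2 + 1) * (q * (q + 1)) := by
  have h1 := sum_card_filter_comm (univ : Finset (Point K)) S PointOnLine
  simp only [card_points_on, h.card_field, Finset.sum_const, smul_eq_mul] at h1
  have h2 : ∀ x : Point K, 2 * #{l ∈ S | PointOnLine x l}
      = (if Black S x then q ^ 2 - q else 0) + q * (q + 1) := by
    intro x
    have h4 : q ≤ q ^ 2 := Nat.le_self_pow two_ne_zero q
    split_ifs with hx
    · rw [Black, h.card_field] at hx
      rw [hx]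
      have : q * (q + 1) = q ^ 2 + q := by ring
      omega
    · rw [h.white_iff.2 hx, zero_add]
  rw [mul_assoc, ← h1, Finset.mul_sum, Finset.sum_congr rfl fun x _ => h2 x,
    Finset.sum_add_distrib, Finset.sum_const, Finset.card_univ, card_points, h.card_field,
    ← Finset.sum_filter, Finset.sum_const, smul_eq_mul, smul_eq_mul]

theorem card_mul_eq_tangent (h : IsSecantFamily S q) :
    2 * #S * (q + 1) = #{π : Plane K | Tangent S π} * (q ^ 2 - q)
      + (q + 1) * (q ^ 2 + 1) * (q * (q + 1)) := by
  have h1 := sum_card_filter_comm (univ : Finset (Plane K)) S (fun π l => LineInPlane l π)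
  simp only [card_planes_on, h.card_field, Finset.sum_const, smul_eq_mul] at h1
  have h2 : ∀ π : Plane K, 2 * #{l ∈ S | LineInPlane l π}
      = (if Tangent S π then q ^ 2 - q else 0) + q * (q + 1) := by
    intro π
    have h4 : q ≤ q ^ 2 := Nat.le_self_pow two_ne_zero q
    split_ifs with hx
    · rw [Tangent, h.card_field] at hx
      rw [hx]
      have : q * (q + 1) = q ^ 2 + q := by ring
      omega
    · rw [h.secant_iff.2 hx, zero_add]
  rw [mul_assoc, ← h1, Finset.mul_sum, Finset.sum_congr rfl fun x _ => h2 x,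
    Finset.sum_add_distrib, Finset.sum_const, Finset.card_univ, card_planes, card_points,
    h.card_field, ← Finset.sum_filter, Finset.sum_const, smul_eq_mul, smul_eq_mul]

theorem card_black_eq_card_tangent (h : IsSecantFamily S q) :
    #{x : Point K | Black S x} = #{π : Plane K | Tangent S π} := by
  have h3 := h.three_le
  have h1 := h.card_mul_eq_black
  rw [h.card_mul_eq_tangent] at h1
  have h2 : 0 < q ^ 2 - q := by
    have : q * 3 ≤ q * q := Nat.mul_le_mul_left q h3
    rw [pow_two]
    omega
  exact (Nat.eq_of_mul_eq_mul_right h2 (by omega)).symm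

/-- The poles of tangent planes are black: polarity is an injection from the black points to the
tangent planes, which are equally many. -/
theorem exists_pole (h : IsSecantFamily S q) {π : Plane K} (hπ : Tangent S π) :
    ∃ x, Black S x ∧ IsPole S x π := by
  have h1 : ∀ x ∈ ({x | Black S x} : Finset (Point K)),
      #{σ ∈ ({σ | Tangent S σ} : Finset (Plane K)) | IsPole S x σ} = 1 := by
    intro x hx
    obtain ⟨σ, hσ, hxσ⟩ := h.exists_polar (mem_filter.1 hx).2
    refine Finset.card_eq_one.2 ⟨σ, ?_⟩
    ext τ
    simp only [mem_filter, mem_univ, true_and, mem_singleton]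
    exact ⟨fun hτ => hτ.2.plane_unique hxσ, fun e => e ▸ ⟨hσ, hxσ⟩⟩
  have h2 : ∀ σ ∈ ({σ | Tangent S σ} : Finset (Plane K)),
      #{x ∈ ({x | Black S x} : Finset (Point K)) | IsPole S x σ} ≤ 1 := by
    intro σ _
    refine Finset.card_le_one.2 fun x hx y hy => ?_
    exact (mem_filter.1 hx).2.point_unique (mem_filter.1 hy).2
  have h3 := sum_card_filter_comm ({x | Black S x} : Finset (Point K))
    ({σ | Tangent S σ} : Finset (Plane K)) (IsPole S)
  rw [Finset.sum_congr rfl h1, Finset.sum_const, h.card_black_eq_card_tangent,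
    ← Finset.sum_const] at h3
  have h4 := (Finset.sum_eq_sum_iff_of_le h2).1 h3.symm π (by simpa using hπ)
  obtain ⟨x, hx⟩ := Finset.card_pos.1 (h4.ge.trans_lt' Nat.zero_lt_one)
  simp only [mem_filter, mem_univ, true_and] at hx
  exact ⟨x, hx⟩

theorem pencilCard_of_pole_point (h : IsSecantFamily S q) {x : Point K} {π σ : Plane K}
    (hp : IsPole S x π) (hx : PointInPlane x σ) (hne : σ ≠ π) : pencilCard S x σ = q := by
  have h1 := pencilCard_add S hx
  have h2 := h.pencilCard_le hx
  have h3 : #{l : Line K | l ∉ S ∧ PointOnLine x l ∧ LineInPlane l σ} ≤ 1 := by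
    refine Finset.card_le_one.2 fun l hl m hm => ?_
    simp only [mem_filter, mem_univ, true_and] at hl hm
    by_contra hlm
    exact hne (PG3.plane_unique hlm hl.2.1 hm.2.1 hl.2.2 hm.2.2
      (not_not.1 fun hn => hl.1 ((hp.through l hl.2.1).2 hn))
      (not_not.1 fun hn => hm.1 ((hp.through m hm.2.1).2 hn)))
  rw [h.card_field] at h1
  omega

theorem pencilCard_of_pole_plane (h : IsSecantFamily S q) {x y : Point K} {π : Plane K}
    (hp : IsPole S x π) (hy : PointInPlane y π) (hne : y ≠ x) : pencilCard S y π = q := by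
  have h1 := pencilCard_add S hy
  have h2 := h.pencilCard_le hy
  have h3 : #{l : Line K | l ∉ S ∧ PointOnLine y l ∧ LineInPlane l π} ≤ 1 := by
    refine Finset.card_le_one.2 fun l hl m hm => ?_
    simp only [mem_filter, mem_univ, true_and] at hl hm
    exact line_unique hne hl.2.1
      (not_not.1 fun hn => hl.1 ((hp.inside l hl.2.2).2 hn)) hm.2.1
      (not_not.1 fun hn => hm.1 ((hp.inside m hm.2.2).2 hn))
  rw [h.card_field] at h1
  omega

theorem pencilCard_of_black_of_secant (h : IsSecantFamily S q) {x : Point K} {π : Plane K}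
    (hx : Black S x) (hxπ : PointInPlane x π) (hπ : ¬ Tangent S π) : pencilCard S x π = q := by
  obtain ⟨σ, hσ, hp⟩ := h.exists_polar hx
  exact h.pencilCard_of_pole_point hp hxπ fun e => hπ (e ▸ hσ)

theorem pencilCard_of_black_of_mem (h : IsSecantFamily S q) {x : Point K} {l : Line K}
    {π : Plane K} (hx : Black S x) (hl : l ∈ S) (hxl : PointOnLine x l) (hlπ : LineInPlane l π) :
    pencilCard S x π = q := by
  obtain ⟨σ, hσ, hp⟩ := h.exists_polar hx
  refine h.pencilCard_of_pole_point hp (hxl.inPlane hlπ) ?_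
  rintro rfl
  exact (hp.through l hxl).1 hl hlπ

theorem pencilCard_of_tangent_of_mem (h : IsSecantFamily S q) {x : Point K} {l : Line K}
    {π : Plane K} (hπ : Tangent S π) (hl : l ∈ S) (hxl : PointOnLine x l)
    (hlπ : LineInPlane l π) : pencilCard S x π = q := by
  obtain ⟨y, hy, hp⟩ := h.exists_pole hπ
  refine h.pencilCard_of_pole_plane hp (hxl.inPlane hlπ) ?_
  rintro rfl
  exact (hp.through l hxl).1 hl hlπ

theorem pencilCard_white (h : IsSecantFamily S q) {x : Point K} {π : Plane K}
    (hx : ¬ Black S x) (hxπ : PointInPlane x π) :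
    2 * pencilCard S x π + 1 = q ∨ 2 * pencilCard S x π = q + 1 ∨ pencilCard S x π = q := by
  by_cases hπ : Tangent S π
  · obtain ⟨y, hy, hp⟩ := h.exists_pole hπ
    exact Or.inr (Or.inr (h.pencilCard_of_pole_plane hp hxπ fun e => hx (e ▸ hy)))
  · exact h.pencil_secant π (h.secant_iff.2 hπ) x hxπ

theorem secant_plane (h : IsSecantFamily S q) {π : Plane K} (hπ : ¬ Tangent S π) {l : Line K}
    (hl : LineInPlane l π) :
    (l ∈ S → #{x : Point K | PointOnLine x l ∧ pencilCard S x π = q} = 2) ∧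
      (l ∉ S → #{x : Point K | PointOnLine x l ∧ pencilCard S x π = q} ≤ 1) := by
  have h3 := h.three_le
  have key := (isProjPlane_plane π).card_full_points (T := S.filter (LineInPlane · π))
    (by rw [h.card_field]; omega)
    (fun l hl => by simpa using (mem_filter.1 hl).2) (by rw [h.card_field]; exact h.secant_iff.2 hπ)
    (fun x hx => by
      rw [filter_plane_pencil, h.card_field]
      exact h.pencil_secant π (h.secant_iff.2 hπ) x (by simpa using hx))
  simp only [filter_plane_pencil, h.card_field] at key
  have e : #{x : Point K | PointOnLine x l ∧ pencilCard S x π = q}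
      = #{x ∈ ({x | PointInPlane x π} : Finset (Point K)) |
          PointOnLine x l ∧ pencilCard S x π = q} := by
    rw [Finset.filter_filter]
    congr 1
    ext x
    simp only [mem_filter, mem_univ, true_and]
    have : PointOnLine x l → PointInPlane x π := fun hx => hx.inPlane hl
    tauto
  rw [e]
  exact ⟨fun hS => key.1 l (mem_filter.2 ⟨hS, hl⟩),
    fun hS => key.2 l (by simpa using hl) fun hS' => hS (mem_filter.1 hS').1⟩

theorem white_point (h : IsSecantFamily S q) {x : Point K} (hx : ¬ Black S x) {l : Line K}
    (hl : PointOnLine x l) (hS : l ∈ S) :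
    #{π : Plane K | LineInPlane l π ∧ pencilCard S x π = q} = 2 := by
  have h3 := h.three_le
  have key := (isProjPlane_point x).card_full_points (T := S.filter (PointOnLine x ·))
    (by rw [h.card_field]; omega)
    (fun l hl => by simpa using (mem_filter.1 hl).2) (by rw [h.card_field]; exact h.white_iff.2 hx)
    (fun π hπ => by
      rw [filter_point_pencil, h.card_field]
      exact h.pencilCard_white hx (by simpa using hπ))
  simp only [filter_point_pencil, h.card_field] at key
  have e : #{π : Plane K | LineInPlane l π ∧ pencilCard S x π = q}
      = #{π ∈ ({π | PointInPlane x π} : Finset (Plane K)) |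
          LineInPlane l π ∧ pencilCard S x π = q} := by
    rw [Finset.filter_filter]
    congr 1
    ext π
    simp only [mem_filter, mem_univ, true_and]
    have : LineInPlane l π → PointInPlane x π := fun hx => hl.inPlane hx
    tauto
  rw [e]
  exact key.1 l (mem_filter.2 ⟨hS, hl⟩)

/-- Every line is on as many tangent planes as black points.  Off `S` this is polarity; on `S` the
flags `(x, π)` around the line whose pencil has `q` lines of `S` are counted in two ways. -/
theorem blackCard_eq_tangentCard (h : IsSecantFamily S q) (l : Line K) :
    blackCard S l = tangentCard S l := by
  have hq3 := h.three_le
  by_cases hl : l ∈ S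
  · have h1 := sum_card_filter_comm ({x | PointOnLine x l} : Finset (Point K))
      ({π | LineInPlane l π} : Finset (Plane K)) (fun x π => pencilCard S x π = q)
    have h2 : ∀ x ∈ ({x | PointOnLine x l} : Finset (Point K)),
        #{π ∈ ({π | LineInPlane l π} : Finset (Plane K)) | pencilCard S x π = q}
          = (if Black S x then q - 1 else 0) + 2 := by
      intro x hx
      simp only [mem_filter, mem_univ, true_and] at hx
      split_ifs with hb
      · rw [Finset.filter_true_of_mem, card_planes_on, h.card_field]
        · omega
        · intro π hπ
          exact h.pencilCard_of_black_of_mem hb hl hx (by simpa using hπ)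
      · rw [Finset.filter_filter, h.white_point hb hx hl]
    have h3 : ∀ π ∈ ({π | LineInPlane l π} : Finset (Plane K)),
        #{x ∈ ({x | PointOnLine x l} : Finset (Point K)) | pencilCard S x π = q}
          = (if Tangent S π then q - 1 else 0) + 2 := by
      intro π hπ
      simp only [mem_filter, mem_univ, true_and] at hπ
      split_ifs with hb
      · rw [Finset.filter_true_of_mem, card_points_on, h.card_field]
        · omega
        · intro x hx
          exact h.pencilCard_of_tangent_of_mem hb hl (by simpa using hx) hπ
      · rw [Finset.filter_filter, (h.secant_plane hb hπ).1 hl]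
    rw [Finset.sum_congr rfl h2, Finset.sum_congr rfl h3, Finset.sum_add_distrib,
      Finset.sum_add_distrib, Finset.sum_const, Finset.sum_const, card_points_on, card_planes_on,
      ← Finset.sum_filter, ← Finset.sum_filter, Finset.filter_filter, Finset.filter_filter,
      Finset.sum_const, Finset.sum_const, smul_eq_mul, smul_eq_mul] at h1
    exact Nat.eq_of_mul_eq_mul_right (show 0 < q - 1 by omega) (Nat.add_right_cancel h1)
  · have h1 := sum_card_filter_comm ({x | PointOnLine x l ∧ Black S x} : Finset (Point K))
      ({π | LineInPlane l π ∧ Tangent S π} : Finset (Plane K)) (IsPole S)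
    have h2 : ∀ x ∈ ({x | PointOnLine x l ∧ Black S x} : Finset (Point K)),
        #{π ∈ ({π | LineInPlane l π ∧ Tangent S π} : Finset (Plane K)) | IsPole S x π} = 1 := by
      intro x hx
      simp only [mem_filter, mem_univ, true_and] at hx
      obtain ⟨σ, hσ, hp⟩ := h.exists_polar hx.2
      refine Finset.card_eq_one.2 ⟨σ, ?_⟩
      ext τ
      simp only [mem_filter, mem_univ, true_and, mem_singleton]
      refine ⟨fun hτ => hτ.2.plane_unique hp, ?_⟩
      rintro rfl
      exact ⟨⟨not_not.1 fun hn => hl ((hp.through l hx.1).2 hn), hσ⟩, hp⟩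
    have h3 : ∀ π ∈ ({π | LineInPlane l π ∧ Tangent S π} : Finset (Plane K)),
        #{x ∈ ({x | PointOnLine x l ∧ Black S x} : Finset (Point K)) | IsPole S x π} = 1 := by
      intro π hπ
      simp only [mem_filter, mem_univ, true_and] at hπ
      obtain ⟨y, hy, hp⟩ := h.exists_pole hπ.2
      refine Finset.card_eq_one.2 ⟨y, ?_⟩
      ext z
      simp only [mem_filter, mem_univ, true_and, mem_singleton]
      refine ⟨fun hz => hz.2.point_unique hp, ?_⟩
      rintro rfl
      exact ⟨⟨not_not.1 fun hn => hl ((hp.inside l hπ.1).2 hn), hy⟩, hp⟩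
    rw [Finset.sum_congr rfl h2, Finset.sum_congr rfl h3] at h1
    simpa [blackCard, tangentCard] using h1

theorem blackCard_cases (h : IsSecantFamily S q) (l : Line K) :
    blackCard S l = q + 1 ∨ (blackCard S l ≤ 2 ∧ (l ∉ S → blackCard S l ≤ 1)) := by
  by_cases ht : ∀ π, LineInPlane l π → Tangent S π
  · left
    rw [h.blackCard_eq_tangentCard, tangentCard, ← h.card_field, ← card_planes_on l]
    congr 1
    ext π
    simpa using ht π
  · right
    push Not at ht
    obtain ⟨π, hlπ, hπ⟩ := ht
    have hle : blackCard S l ≤ #{x : Point K | PointOnLine x l ∧ pencilCard S x π = q} := by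
      refine Finset.card_le_card fun x hx => ?_
      simp only [mem_filter, mem_univ, true_and] at hx ⊢
      exact ⟨hx.1, h.pencilCard_of_black_of_secant hx.2 (hx.1.inPlane hlπ) hπ⟩
    have h1 := h.secant_plane hπ hlπ
    by_cases hl : l ∈ S
    · have := h1.1 hl
      exact ⟨by omega, fun hn => absurd hl hn⟩
    · have := h1.2 hl
      exact ⟨by omega, fun _ => by omega⟩

theorem black_of_blackCard_eq (h : IsSecantFamily S q) {l : Line K} (hl : blackCard S l = q + 1)
    {x : Point K} (hx : PointOnLine x l) : Black S x := by
  have h1 : ({x | PointOnLine x l ∧ Black S x} : Finset (Point K))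
      = ({x | PointOnLine x l} : Finset (Point K)) := by
    refine Finset.eq_of_subset_of_card_le (fun y hy => ?_) ?_
    · simp only [mem_filter, mem_univ, true_and] at hy ⊢
      exact hy.1
    · rw [card_points_on, h.card_field]
      exact hl.ge
  have h2 : x ∈ ({x | PointOnLine x l ∧ Black S x} : Finset (Point K)) := by
    rw [h1]; simpa using hx
  exact (by simpa using h2 : _ ∧ _).2

theorem tangent_of_blackCard_eq (h : IsSecantFamily S q) {l : Line K}
    (hl : blackCard S l = q + 1) {π : Plane K} (hπ : LineInPlane l π) : Tangent S π := by
  rw [h.blackCard_eq_tangentCard] at hl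
  have h1 : ({π | LineInPlane l π ∧ Tangent S π} : Finset (Plane K))
      = ({π | LineInPlane l π} : Finset (Plane K)) := by
    refine Finset.eq_of_subset_of_card_le (fun y hy => ?_) ?_
    · simp only [mem_filter, mem_univ, true_and] at hy ⊢
      exact hy.1
    · rw [card_planes_on, h.card_field]
      exact hl.ge
  have h2 : π ∈ ({π | LineInPlane l π ∧ Tangent S π} : Finset (Plane K)) := by
    rw [h1]; simpa using hπ
  exact (by simpa using h2 : _ ∧ _).2

theorem blackCard_eq_of_two (h : IsSecantFamily S q) {l : Line K} (hl : l ∉ S) {x y : Point K}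
    (hne : x ≠ y) (hxl : PointOnLine x l) (hyl : PointOnLine y l) (hx : Black S x)
    (hy : Black S y) : blackCard S l = q + 1 := by
  refine (h.blackCard_cases l).resolve_right fun hc => ?_
  have h1 := hc.2 hl
  rw [blackCard, Finset.card_le_one] at h1
  exact hne (h1 x (by simp [hxl, hx]) y (by simp [hyl, hy]))

/-- A line all of whose points are black is not in `S`: otherwise every plane on it is tangent with
pole off the line, so that all points of that plane, hence all points of the space, are black. -/
theorem not_mem_of_blackCard_eq (h : IsSecantFamily S q) {l : Line K}
    (hb : blackCard S l = q + 1) : l ∉ S := by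
  intro hl
  obtain ⟨w, hw⟩ := h.exists_white
  refine h.white_iff.1 hw ?_
  by_cases hwl : PointOnLine w l
  · exact h.black_of_blackCard_eq hb hwl
  obtain ⟨π, hwπ, hlπ⟩ := exists_plane hwl
  obtain ⟨p, hp, hpole⟩ := h.exists_pole (h.tangent_of_blackCard_eq hb hlπ)
  have hpl : ¬ PointOnLine p l := (hpole.inside l hlπ).1 hl
  by_cases hwp : w = p
  · exact hwp ▸ hp
  obtain ⟨m, hwm, hpm⟩ := exists_line_through hwp
  have hmπ := lineInPlane_of_ne hwp hwm hpm hwπ hpole.mem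
  have hmS : m ∉ S := fun hm => (hpole.inside m hmπ).1 hm hpm
  have hml : m ≠ l := fun e => hwl (e ▸ hwm)
  obtain ⟨y, hym, hyl⟩ := exists_meet hml hmπ hlπ
  have hyp : y ≠ p := fun e => hpl (e ▸ hyl)
  exact h.black_of_blackCard_eq
    (h.blackCard_eq_of_two hmS hyp hym hpm (h.black_of_blackCard_eq hb hyl) hp) hwm

theorem blackCard_le_two (h : IsSecantFamily S q) {l : Line K} (hl : l ∈ S) :
    blackCard S l ≤ 2 := by
  rcases h.blackCard_cases l with h1 | h1
  · exact absurd hl (h.not_mem_of_blackCard_eq h1)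
  · exact h1.1

end IsSecantFamily

end Chain
/-! ### The number of black points -/

section Count

open Finset
open scoped Classical

variable {K : Type*} [Field K] [Fintype K] {S : Finset (Line K)} {q : ℕ}

theorem card_lines_joining {x y : Point K} (h : x ≠ y) :
    #{l ∈ ({l | PointOnLine x l} : Finset (Line K)) | PointOnLine y l} = 1 := by
  obtain ⟨l, hx, hy⟩ := exists_line_through h
  refine Finset.card_eq_one.2 ⟨l, ?_⟩
  ext m
  simp only [mem_filter, mem_univ, true_and, mem_singleton]
  exact ⟨fun hm => line_unique h hm.1 hm.2 hx hy, fun e => e ▸ ⟨hx, hy⟩⟩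

namespace IsSecantFamily

theorem sum_blackCard_through (h : IsSecantFamily S q) (x : Point K) :
    ∑ l : Line K with PointOnLine x l, blackCard S l
      = #{y : Point K | Black S y} + if Black S x then q ^ 2 + q else 0 := by
  have h1 := sum_card_filter_comm ({y | Black S y} : Finset (Point K))
    ({l | PointOnLine x l} : Finset (Line K)) PointOnLine
  have h2 : ∀ y ∈ ({y | Black S y} : Finset (Point K)),
      #{l ∈ ({l | PointOnLine x l} : Finset (Line K)) | PointOnLine y l}
        = 1 + if x = y then q ^ 2 + q else 0 := by
    intro y _
    split_ifs with hxy
    · subst hxy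
      rw [Finset.filter_filter]
      simp only [and_self]
      rw [card_lines_through, h.card_field]
      ring
    · rw [card_lines_joining hxy]
  rw [Finset.sum_congr rfl h2, Finset.sum_add_distrib, Finset.sum_const, Finset.sum_ite_eq] at h1
  simp only [smul_eq_mul, mul_one, mem_filter, mem_univ, true_and, Finset.filter_filter] at h1
  rw [h1]
  refine Finset.sum_congr rfl fun l _ => ?_
  rw [blackCard]
  simp only [and_comm]

theorem sum_tangentCard_through (h : IsSecantFamily S q) (x : Point K) :
    ∑ l : Line K with PointOnLine x l, tangentCard S l
      = #{π : Plane K | PointInPlane x π ∧ Tangent S π} * (q + 1) := by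
  have h1 := sum_card_filter_comm ({π | PointInPlane x π ∧ Tangent S π} : Finset (Plane K))
    ({l | PointOnLine x l} : Finset (Line K)) (fun π l => LineInPlane l π)
  have h2 : ∀ π ∈ ({π | PointInPlane x π ∧ Tangent S π} : Finset (Plane K)),
      #{l ∈ ({l | PointOnLine x l} : Finset (Line K)) | LineInPlane l π} = q + 1 := by
    intro π hπ
    rw [Finset.filter_filter, card_pencil (mem_filter.1 hπ).2.1, h.card_field]
  rw [Finset.sum_congr rfl h2, Finset.sum_const, smul_eq_mul] at h1
  rw [h1]
  refine Finset.sum_congr rfl fun l hl => ?_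
  rw [tangentCard, Finset.filter_filter]
  congr 1
  ext π
  simp only [mem_filter, mem_univ, true_and]
  have : LineInPlane l π → PointInPlane x π := fun hπ =>
    PointOnLine.inPlane (by simpa using hl) hπ
  tauto

theorem card_black_eq_of_white (h : IsSecantFamily S q) {x : Point K} (hx : ¬ Black S x) :
    #{y : Point K | Black S y} = #{π : Plane K | PointInPlane x π ∧ Tangent S π} * (q + 1) := by
  rw [← h.sum_tangentCard_through x, ← Finset.sum_congr rfl fun l _ =>
    h.blackCard_eq_tangentCard l, h.sum_blackCard_through, if_neg hx, add_zero]

theorem card_black_eq_of_black (h : IsSecantFamily S q) {x : Point K} (hx : Black S x) :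
    #{y : Point K | Black S y} + (q ^ 2 + q)
      = #{π : Plane K | PointInPlane x π ∧ Tangent S π} * (q + 1) := by
  rw [← h.sum_tangentCard_through x, ← Finset.sum_congr rfl fun l _ =>
    h.blackCard_eq_tangentCard l, h.sum_blackCard_through, if_pos hx]

theorem blackCard_of_black_of_not_mem (h : IsSecantFamily S q) {x : Point K} {l : Line K}
    (hx : Black S x) (hxl : PointOnLine x l) (hl : l ∉ S) :
    blackCard S l = 1 + if blackCard S l = q + 1 then q else 0 := by
  split_ifs with hb
  · omega
  · have h1 := ((h.blackCard_cases l).resolve_left hb).2 hl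
    have h2 : 0 < blackCard S l := Finset.card_pos.2 ⟨x, by simp [hxl, hx]⟩
    omega

/-- The tangent planes on a black point `x` are its polar plane and, for every line of black points
through `x`, the `q` other planes on that line: count in two ways the pairs of a tangent plane and
a line through `x` that is contained in it and not in `S`. -/
theorem card_tangent_through (h : IsSecantFamily S q) {x : Point K} (hx : Black S x) :
    #{π : Plane K | PointInPlane x π ∧ Tangent S π}
      = 1 + q * #{l : Line K | PointOnLine x l ∧ blackCard S l = q + 1} := by
  obtain ⟨σ, hσ, hp⟩ := h.exists_polar hx
  have h1 := sum_card_filter_comm ({π | PointInPlane x π ∧ Tangent S π} : Finset (Plane K))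
    ({l | l ∉ S ∧ PointOnLine x l} : Finset (Line K)) (fun π l => LineInPlane l π)
  have h2 : ∀ π ∈ ({π | PointInPlane x π ∧ Tangent S π} : Finset (Plane K)),
      #{l ∈ ({l | l ∉ S ∧ PointOnLine x l} : Finset (Line K)) | LineInPlane l π}
        = 1 + if σ = π then q else 0 := by
    intro π hπ
    simp only [mem_filter, mem_univ, true_and] at hπ
    have h3 := pencilCard_add S hπ.1
    rw [h.card_field] at h3
    rw [Finset.filter_filter]
    simp only [and_assoc]
    split_ifs with hσπ
    · subst hσπ
      have : pencilCard S x σ = 0 := by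
        rw [pencilCard, Finset.card_eq_zero, Finset.filter_eq_empty_iff]
        rintro l hl ⟨h1, h2⟩
        exact (hp.through l h1).1 hl h2
      omega
    · rw [h.pencilCard_of_pole_point hp hπ.1 (Ne.symm hσπ)] at h3
      omega
  have h4 : ∀ l ∈ ({l | l ∉ S ∧ PointOnLine x l} : Finset (Line K)),
      #{π ∈ ({π | PointInPlane x π ∧ Tangent S π} : Finset (Plane K)) | LineInPlane l π}
        = 1 + if blackCard S l = q + 1 then q else 0 := by
    intro l hl
    simp only [mem_filter, mem_univ, true_and] at hl
    rw [← h.blackCard_of_black_of_not_mem hx hl.2 hl.1, h.blackCard_eq_tangentCard, tangentCard,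
      Finset.filter_filter]
    congr 1
    ext π
    simp only [mem_filter, mem_univ, true_and]
    have : LineInPlane l π → PointInPlane x π := fun hπ => hl.2.inPlane hπ
    tauto
  have h5 : #{l : Line K | l ∉ S ∧ PointOnLine x l} = q + 1 := by
    rw [← h.card_field, ← card_pencil hp.mem]
    congr 1
    ext l
    simp only [mem_filter, mem_univ, true_and]
    constructor
    · rintro ⟨a, b⟩
      exact ⟨b, not_not.1 fun hn => a ((hp.through l b).2 hn)⟩
    · rintro ⟨a, b⟩
      exact ⟨fun hn => (hp.through l a).1 hn b, a⟩
  have h6 : #{l ∈ ({l | l ∉ S ∧ PointOnLine x l} : Finset (Line K)) | blackCard S l = q + 1}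
      = #{l : Line K | PointOnLine x l ∧ blackCard S l = q + 1} := by
    rw [Finset.filter_filter]
    congr 1
    ext l
    simp only [mem_filter, mem_univ, true_and]
    have : blackCard S l = q + 1 → l ∉ S := fun hb => h.not_mem_of_blackCard_eq hb
    tauto
  rw [Finset.sum_congr rfl h2, Finset.sum_congr rfl h4, Finset.sum_add_distrib,
    Finset.sum_add_distrib, Finset.sum_const, Finset.sum_const, h5, Finset.sum_ite_eq,
    if_pos (by simp [hσ, hp.mem]), ← Finset.sum_filter, Finset.sum_const, h6] at h1
  simp only [smul_eq_mul, mul_one] at h1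
  rw [mul_comm q]
  omega

theorem card_black_lines_le_two (h : IsSecantFamily S q) {x : Point K} (hx : Black S x) :
    #{l : Line K | PointOnLine x l ∧ blackCard S l = q + 1} ≤ 2 := by
  obtain ⟨σ, hσ, hp⟩ := h.exists_polar hx
  obtain ⟨y, hy, hyx⟩ : ∃ y, PointInPlane y σ ∧ y ≠ x := by
    by_contra! hc
    have h1 := card_points_in σ
    have h2 : #{y : Point K | PointInPlane y σ} ≤ 1 := by
      refine Finset.card_le_one.2 fun a ha b hb => ?_
      simp only [mem_filter, mem_univ, true_and] at ha hb
      rw [hc a ha, hc b hb]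
    have := h.three_le
    have := h.card_field
    omega
  obtain ⟨m, hym, hmσ, hxm⟩ := exists_line_avoiding hy hyx
  refine le_trans ?_ (h.blackCard_le_two ((hp.inside m hmσ).2 hxm))
  refine Finset.card_le_card_of_forall_subsingleton (fun l y => PointOnLine y l) ?_ ?_
  · intro l hl
    simp only [mem_filter, mem_univ, true_and] at hl ⊢
    have hlS := h.not_mem_of_blackCard_eq hl.2
    have hlσ : LineInPlane l σ := not_not.1 fun hn => hlS ((hp.through l hl.1).2 hn)
    have hlm : l ≠ m := fun e => hxm (by rw [← e]; exact hl.1)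
    obtain ⟨z, hzl, hzm⟩ := exists_meet hlm hlσ hmσ
    exact ⟨z, ⟨hzm, h.black_of_blackCard_eq hl.2 hzl⟩, hzl⟩
  · intro z hz a ha b hb
    simp only [mem_filter, mem_univ, true_and, Set.mem_ofPred_eq] at hz ha hb
    have hxz : x ≠ z := fun e => hxm (e ▸ hz.1)
    exact line_unique hxz ha.1.1 ha.2 hb.1.1 hb.2

/-- There are `q + 1` or `(q + 1) ^ 2` black points, and correspondingly each black point is on one
or two lines all of whose points are black.  If `t` is the number of tangent planes on a white
point and `m` the number of black lines on a black point, then `t + q = 1 + q * m` with `t > 0` and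
`m ≤ 2`. -/
theorem card_black_cases (h : IsSecantFamily S q) :
    (#{x : Point K | Black S x} = q + 1 ∧ ∃ l : Line K, blackCard S l = q + 1) ∨
      (#{x : Point K | Black S x} = (q + 1) ^ 2 ∧ ∀ x : Point K, Black S x →
        #{l : Line K | PointOnLine x l ∧ blackCard S l = q + 1} = 2) := by
  have hq := h.three_le
  obtain ⟨w, hw⟩ := h.exists_white
  obtain ⟨b, hb⟩ := h.exists_black
  have hbB : Black S b := by rw [Black, h.card_field]; exact hb
  have hB := h.card_black_eq_of_white (h.white_iff.1 hw)
  have hpos : 0 < #{x : Point K | Black S x} := Finset.card_pos.2 ⟨b, by simpa using hbB⟩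
  generalize #{π : Plane K | PointInPlane w π ∧ Tangent S π} = t at hB
  have ht : 0 < t := by
    rcases Nat.eq_zero_or_pos t with h0 | h0
    · rw [h0, zero_mul] at hB; omega
    · exact h0
  have key : ∀ x : Point K, Black S x →
      t + q = 1 + q * #{l : Line K | PointOnLine x l ∧ blackCard S l = q + 1} := by
    intro x hx
    have h1 := h.card_black_eq_of_black hx
    rw [h.card_tangent_through hx, hB] at h1
    refine Nat.eq_of_mul_eq_mul_right (Nat.succ_pos q) ?_
    rw [Nat.succ_eq_add_one, ← h1]
    ring
  have hkb := key b hbB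
  have hm := h.card_black_lines_le_two hbB
  obtain hm1 | hm1 | hm1 : #{l : Line K | PointOnLine b l ∧ blackCard S l = q + 1} = 0 ∨
    #{l : Line K | PointOnLine b l ∧ blackCard S l = q + 1} = 1 ∨
    #{l : Line K | PointOnLine b l ∧ blackCard S l = q + 1} = 2 := by omega
  · rw [hm1] at hkb; omega
  · left
    rw [hm1] at hkb
    have : t = 1 := by omega
    refine ⟨by rw [hB, this, one_mul], ?_⟩
    obtain ⟨l, hl⟩ := Finset.card_pos.1 (hm1.ge.trans_lt' Nat.zero_lt_one)
    exact ⟨l, (mem_filter.1 hl).2.2⟩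
  · right
    rw [hm1] at hkb
    have : t = q + 1 := by omega
    refine ⟨by rw [hB, this, pow_two], fun x hx => ?_⟩
    have hkx := key x hx
    have : q * #{l : Line K | PointOnLine x l ∧ blackCard S l = q + 1} = q * 2 := by omega
    exact Nat.eq_of_mul_eq_mul_left (by omega) this

theorem exists_line_of_card_black (h : IsSecantFamily S q)
    (hB : #{x : Point K | Black S x} = q + 1) {l : Line K} (hl : blackCard S l = q + 1) :
    (∀ x, Black S x ↔ PointOnLine x l) ∧ l ∉ S ∧ 2 * #S = q ^ 4 + q ^ 3 + 2 * q ^ 2 := by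
  refine ⟨fun x => ⟨fun hx => ?_, h.black_of_blackCard_eq hl⟩, h.not_mem_of_blackCard_eq hl, ?_⟩
  · have h1 : ({x | PointOnLine x l ∧ Black S x} : Finset (Point K))
        = ({x | Black S x} : Finset (Point K)) := by
      refine Finset.eq_of_subset_of_card_le (fun y hy => ?_) ?_
      · simp only [mem_filter, mem_univ, true_and] at hy ⊢
        exact hy.2
      · rw [hB]
        exact hl.ge
    have h2 : x ∈ ({x | PointOnLine x l ∧ Black S x} : Finset (Point K)) := by
      rw [h1]; simpa using hx
    exact (by simpa using h2 : _ ∧ _).1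
  · have h1 := h.card_mul_eq_black
    rw [hB] at h1
    refine Nat.eq_of_mul_eq_mul_right (Nat.succ_pos q) (h1.trans ?_)
    have h2 : q ≤ q ^ 2 := Nat.le_self_pow two_ne_zero q
    zify [h2]
    ring

theorem mem_iff_blackCard_eq_two (h : IsSecantFamily S q)
    (hB : #{x : Point K | Black S x} = (q + 1) ^ 2) (l : Line K) :
    l ∈ S ↔ blackCard S l = 2 := by
  have hq := h.three_le
  constructor
  · have h1 := sum_card_filter_comm ({x | Black S x} : Finset (Point K)) S PointOnLine
    have h2 : ∀ x ∈ ({x | Black S x} : Finset (Point K)), #{l ∈ S | PointOnLine x l} = q ^ 2 := by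
      intro x hx
      rw [← h.card_field]
      exact (mem_filter.1 hx).2
    have h3 := h.card_mul_eq_black
    rw [hB] at h3
    have h4 : 2 * #S = (q + 1) ^ 2 * q ^ 2 := by
      refine Nat.eq_of_mul_eq_mul_right (Nat.succ_pos q) (h3.trans ?_)
      have h2 : q ≤ q ^ 2 := Nat.le_self_pow two_ne_zero q
      zify [h2]
      ring
    rw [Finset.sum_congr rfl h2, Finset.sum_const, hB, smul_eq_mul, ← h4, mul_comm, ← smul_eq_mul,
      ← Finset.sum_const] at h1
    have h5 : ∀ l ∈ S, #{x ∈ ({x | Black S x} : Finset (Point K)) | PointOnLine x l}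
        = blackCard S l := by
      intro l _
      rw [blackCard, Finset.filter_filter]
      simp only [and_comm]
    rw [Finset.sum_congr rfl h5] at h1
    exact (Finset.sum_eq_sum_iff_of_le fun l hl => h.blackCard_le_two hl).1 h1.symm l
  · intro h2
    by_contra hl
    rcases h.blackCard_cases l with h3 | h3
    · omega
    · have := h3.2 hl
      omega

end IsSecantFamily

end Count
/-! ### The hyperbolic quadric containing three skew lines -/

section Quadric

variable {K : Type*} [Field K]

theorem rep_mem_iff {x : Point K} {U : Submodule K (Vec K)} : x.rep ∈ U ↔ x.submodule ≤ U := by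
  rw [Projectivization.submodule_eq, Submodule.span_singleton_le_iff_mem]

theorem mk_le_iff {v : Vec K} (hv : v ≠ 0) {U : Submodule K (Vec K)} :
    (Projectivization.mk K v hv).submodule ≤ U ↔ v ∈ U := by
  rw [Projectivization.submodule_mk, Submodule.span_singleton_le_iff_mem]

theorem disjoint_of_no_common_point {l m : Line K}
    (h : ∀ x, PointOnLine x l → ¬ PointOnLine x m) : Disjoint l.1 m.1 := by
  rw [disjoint_iff]
  by_contra hne
  obtain ⟨x, hx⟩ := exists_point_le hne
  exact h x (hx.trans inf_le_left) (hx.trans inf_le_right)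

/-- In suitable coordinates, given by `e`, three pairwise skew lines are `x₂ = x₃ = 0`,
`x₀ = x₁ = 0` and `(x₀, x₁) = (x₂, x₃)`: a basis of the third line is split along the first
two. -/
theorem exists_coordinates {l m n : Line K} (hlm : Disjoint l.1 m.1) (hln : Disjoint l.1 n.1)
    (hmn : Disjoint m.1 n.1) :
    ∃ e : Vec K ≃ₗ[K] Vec K, (∀ v, v ∈ l.1 ↔ e v 2 = 0 ∧ e v 3 = 0) ∧
      (∀ v, v ∈ m.1 ↔ e v 0 = 0 ∧ e v 1 = 0) ∧
      ∀ v, v ∈ n.1 ↔ e v 0 = e v 2 ∧ e v 1 = e v 3 := by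
  have htop : l.1 ⊔ m.1 = ⊤ :=
    Submodule.eq_top_of_disjoint _ _ (by rw [l.2, m.2, finrank_vec]) hlm
  have hsplit : ∀ v : Vec K, ∃ a ∈ l.1, ∃ b ∈ m.1, a + b = v := fun v =>
    Submodule.mem_sup.1 (htop ▸ Submodule.mem_top)
  let b := finBasisOfFinrankEq K n.1 n.2
  obtain ⟨a₀, ha₀, b₀, hb₀, hu₀⟩ := hsplit (b 0)
  obtain ⟨a₁, ha₁, b₁, hb₁, hu₁⟩ := hsplit (b 1)
  have hn₀ : a₀ + b₀ ∈ n.1 := hu₀ ▸ (b 0).2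
  have hn₁ : a₁ + b₁ ∈ n.1 := hu₁ ▸ (b 1).2
  have hind : ∀ s t : K, s • (a₀ + b₀) + t • (a₁ + b₁) = 0 → s = 0 ∧ t = 0 := by
    have hli : LinearIndependent K ![b 0, b 1] := by
      convert b.linearIndependent using 1
      ext i; fin_cases i <;> rfl
    intro s t hst
    refine LinearIndependent.pair_iff.1 hli s t ?_
    rw [hu₀, hu₁] at hst
    exact Subtype.ext (by simpa using hst)
  have ha : ∀ s t : K, s • a₀ + t • a₁ = 0 → s = 0 ∧ t = 0 := by
    intro s t hst
    refine hind s t (Submodule.disjoint_def.1 hmn _ ?_ ?_)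
    · rw [show s • (a₀ + b₀) + t • (a₁ + b₁) = (s • a₀ + t • a₁) + (s • b₀ + t • b₁) by module,
        hst, zero_add]
      exact add_mem (m.1.smul_mem s hb₀) (m.1.smul_mem t hb₁)
    · exact add_mem (n.1.smul_mem s hn₀) (n.1.smul_mem t hn₁)
  have hb : ∀ s t : K, s • b₀ + t • b₁ = 0 → s = 0 ∧ t = 0 := by
    intro s t hst
    refine hind s t (Submodule.disjoint_def.1 hln _ ?_ ?_)
    · rw [show s • (a₀ + b₀) + t • (a₁ + b₁) = (s • a₀ + t • a₁) + (s • b₀ + t • b₁) by module,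
        hst, add_zero]
      exact add_mem (l.1.smul_mem s ha₀) (l.1.smul_mem t ha₁)
    · exact add_mem (n.1.smul_mem s hn₀) (n.1.smul_mem t hn₁)
  have hl : ∀ s t : K, s • a₀ + t • a₁ ∈ l.1 := fun s t =>
    add_mem (l.1.smul_mem s ha₀) (l.1.smul_mem t ha₁)
  have hm : ∀ s t : K, s • b₀ + t • b₁ ∈ m.1 := fun s t =>
    add_mem (m.1.smul_mem s hb₀) (m.1.smul_mem t hb₁)
  have hn : ∀ s t : K, s • (a₀ + b₀) + t • (a₁ + b₁) ∈ n.1 := fun s t =>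
    add_mem (n.1.smul_mem s hn₀) (n.1.smul_mem t hn₁)
  let g : Vec K →ₗ[K] Vec K := Fintype.linearCombination K ![a₀, a₁, b₀, b₁]
  have hg : ∀ c, g c = (c 0 • a₀ + c 1 • a₁) + (c 2 • b₀ + c 3 • b₁) := by
    intro c
    simp [g, Fintype.linearCombination_apply, Fin.sum_univ_four, add_assoc]
  have hgl : ∀ c, g c ∈ l.1 ↔ c 2 = 0 ∧ c 3 = 0 := by
    intro c
    rw [hg]
    constructor
    · intro h
      exact hb _ _ (Submodule.disjoint_def.1 hlm _ ((Submodule.add_mem_iff_right _ (hl _ _)).1 h)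
        (hm _ _))
    · rintro ⟨h2, h3⟩
      rw [h2, h3]
      simpa using hl _ _
  have hgm : ∀ c, g c ∈ m.1 ↔ c 0 = 0 ∧ c 1 = 0 := by
    intro c
    rw [hg]
    constructor
    · intro h
      exact ha _ _ (Submodule.disjoint_def.1 hlm _ (hl _ _)
        ((Submodule.add_mem_iff_left _ (hm _ _)).1 h))
    · rintro ⟨h2, h3⟩
      rw [h2, h3]
      simpa using hm _ _
  have hgn : ∀ c, g c ∈ n.1 ↔ c 0 = c 2 ∧ c 1 = c 3 := by
    intro c
    have key : g c = ((c 0 - c 2) • a₀ + (c 1 - c 3) • a₁)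
        + (c 2 • (a₀ + b₀) + c 3 • (a₁ + b₁)) := by
      rw [hg]; module
    rw [key, Submodule.add_mem_iff_left _ (hn _ _)]
    constructor
    · intro h
      have := ha _ _ (Submodule.disjoint_def.1 hln _ (hl _ _) h)
      exact ⟨sub_eq_zero.1 this.1, sub_eq_zero.1 this.2⟩
    · rintro ⟨h0, h1⟩
      rw [h0, h1]
      simp
  have hinj : Function.Injective g := by
    rw [injective_iff_map_eq_zero]
    intro c hc
    have h1 := (hgl c).1 (hc ▸ zero_mem _)
    have h2 := (hgm c).1 (hc ▸ zero_mem _)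
    ext i
    fin_cases i
    exacts [h2.1, h2.2, h1.1, h1.2]
  let e := (LinearEquiv.ofInjectiveEndo g hinj).symm
  have hge : ∀ v, g (e v) = v := fun v => (LinearEquiv.ofInjectiveEndo g hinj).apply_symm_apply v
  refine ⟨e, fun v => ?_, fun v => ?_, fun v => ?_⟩
  · rw [← hgl, hge]
  · rw [← hgm, hge]
  · rw [← hgn, hge]

/-- The quadratic form `x₀ x₃ - x₁ x₂` in the coordinates given by `e`. -/
def detForm (e : Vec K ≃ₗ[K] Vec K) : QuadraticForm K (Vec K) :=
  QuadraticMap.linMulLin (LinearMap.proj 0 ∘ₗ e.toLinearMap) (LinearMap.proj 3 ∘ₗ e.toLinearMap)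
    - QuadraticMap.linMulLin (LinearMap.proj 1 ∘ₗ e.toLinearMap)
      (LinearMap.proj 2 ∘ₗ e.toLinearMap)

theorem detForm_apply (e : Vec K ≃ₗ[K] Vec K) (v : Vec K) :
    detForm e v = e v 0 * e v 3 - e v 1 * e v 2 := by
  simp [detForm]

theorem polarBilin_detForm (e : Vec K ≃ₗ[K] Vec K) (v w : Vec K) :
    (detForm e).polarBilin v w
      = e v 0 * e w 3 + e w 0 * e v 3 - e v 1 * e w 2 - e w 1 * e v 2 := by
  rw [QuadraticMap.polarBilin_apply_apply, QuadraticMap.polar]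
  simp only [detForm_apply, map_add, Pi.add_apply]
  ring

theorem isHyperbolic_detForm (e : Vec K ≃ₗ[K] Vec K) : IsHyperbolic (detForm e) := by
  have hsep : ∀ v : Vec K, (∀ w, (detForm e).polarBilin v w = 0) → v = 0 := by
    intro v hv
    have h := fun i => hv (e.symm (Pi.single i 1))
    simp only [polarBilin_detForm, LinearEquiv.apply_symm_apply] at h
    have h0 := h 0
    have h1 := h 1
    have h2 := h 2
    have h3 := h 3
    simp at h0 h1 h2 h3
    refine e.map_eq_zero_iff.1 ?_
    ext i
    fin_cases i
    exacts [h3, h2, h1, h0]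
  have hnd : (detForm e).polarBilin.Nondegenerate := by
    refine ⟨hsep, fun w hw => hsep w fun v => ?_⟩
    rw [← hw v, polarBilin_detForm, polarBilin_detForm]
    ring
  refine ⟨hnd, ⟨?_, ?_⟩⟩
  · have hli : LinearIndependent K ![e.symm (Pi.single 0 1), e.symm (Pi.single 1 1)] := by
      rw [LinearIndependent.pair_iff]
      intro s t hst
      have h := congrArg e hst
      simp only [map_add, map_smul, LinearEquiv.apply_symm_apply, map_zero] at h
      have h0 := congrFun h 0
      have h1 := congrFun h 1
      simp at h0 h1
      exact ⟨h0, h1⟩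
    refine ⟨Submodule.span K (Set.range ![e.symm (Pi.single 0 1), e.symm (Pi.single 1 1)]), ?_, ?_⟩
    · intro w hw
      rw [Matrix.range_cons_cons_empty, Submodule.mem_span_pair] at hw
      obtain ⟨s, t, rfl⟩ := hw
      simp [detForm_apply]
    · rw [finrank_span_eq_card hli]
      rfl
  · rintro d ⟨W, hW, rfl⟩
    have h1 : W ≤ LinearMap.BilinForm.orthogonal (detForm e).polarBilin W := by
      intro w hw v hv
      rw [QuadraticMap.polarBilin_apply_apply, QuadraticMap.polar, hW _ (add_mem hv hw), hW _ hv,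
        hW _ hw]
      simp
    have h2 := Submodule.finrank_mono h1
    rw [LinearMap.BilinForm.finrank_orthogonal hnd, finrank_vec] at h2
    omega

/-- Three pairwise skew lines determine a hyperbolic quadric, the union of their transversals. -/
theorem exists_hyperbolic_of_skew {l m n : Line K} (hlm : Disjoint l.1 m.1)
    (hln : Disjoint l.1 n.1) (hmn : Disjoint m.1 n.1) :
    ∃ Q : QuadraticForm K (Vec K), IsHyperbolic Q ∧ ∀ w : Point K, w ∈ quadricPoints Q ↔
      ∃ k : Line K, PointOnLine w k ∧ (∃ x, PointOnLine x l ∧ PointOnLine x k) ∧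
        (∃ y, PointOnLine y m ∧ PointOnLine y k) ∧ ∃ z, PointOnLine z n ∧ PointOnLine z k := by
  obtain ⟨e, hl, hm, hn⟩ := exists_coordinates hlm hln hmn
  have hskew : ∀ {x y : Point K}, PointOnLine x l → PointOnLine y m → x ≠ y := by
    rintro x _ hx hy rfl
    exact x.rep_nonzero (Submodule.disjoint_def.1 hlm _ (rep_mem_iff.2 hx) (rep_mem_iff.2 hy))
  refine ⟨detForm e, isHyperbolic_detForm e, fun w => ⟨fun hw => ?_, ?_⟩⟩
  · have hQ := hw w.rep (rep_mem_iff.2 le_rfl)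
    rw [detForm_apply] at hQ
    -- The two halves of the coordinate vector are proportional, so both are multiples of a
    -- common nonzero pair.
    obtain ⟨α, β, s, t, hne, h0, h1, h2, h3⟩ : ∃ α β s t : K, (α ≠ 0 ∨ β ≠ 0) ∧
        e w.rep 0 = s * α ∧ e w.rep 1 = s * β ∧ e w.rep 2 = t * α ∧ e w.rep 3 = t * β := by
      by_cases h0 : e w.rep 0 = 0
      · by_cases h1 : e w.rep 1 = 0
        · refine ⟨e w.rep 2, e w.rep 3, 0, 1, ?_, by simp [h0], by simp [h1], by simp, by simp⟩
          by_contra! hc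
          refine w.rep_nonzero (e.map_eq_zero_iff.1 ?_)
          ext i
          fin_cases i
          exacts [h0, h1, hc.1, hc.2]
        · have h2 : e w.rep 2 = 0 := by
            rw [h0, zero_mul, zero_sub, neg_eq_zero] at hQ
            exact (mul_eq_zero.1 hQ).resolve_left h1
          exact ⟨0, e w.rep 1, 1, e w.rep 3 / e w.rep 1, Or.inr h1, by simp [h0], by simp,
            by simp [h2], by field_simp⟩
      · refine ⟨e w.rep 0, e w.rep 1, 1, e w.rep 2 / e w.rep 0, Or.inl h0, by simp, by simp,
          by field_simp, ?_⟩
        field_simp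
        linear_combination hQ
    have hy : e.symm ![α, β, 0, 0] ≠ 0 := by
      intro h
      have h' := e.symm.map_eq_zero_iff.1 h
      have a := congrFun h' 0
      have b := congrFun h' 1
      simp at a b
      tauto
    have hz : e.symm ![0, 0, α, β] ≠ 0 := by
      intro h
      have h' := e.symm.map_eq_zero_iff.1 h
      have a := congrFun h' 2
      have b := congrFun h' 3
      simp at a b
      tauto
    have hu : e.symm ![α, β, α, β] ≠ 0 := by
      intro h
      have h' := e.symm.map_eq_zero_iff.1 h
      have a := congrFun h' 0
      have b := congrFun h' 1
      simp at a b
      tauto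
    have hyl : PointOnLine (Projectivization.mk K _ hy) l := (mk_le_iff hy).2 ((hl _).2 (by simp))
    have hzm : PointOnLine (Projectivization.mk K _ hz) m := (mk_le_iff hz).2 ((hm _).2 (by simp))
    have hun : PointOnLine (Projectivization.mk K _ hu) n := (mk_le_iff hu).2 ((hn _).2 (by simp))
    obtain ⟨k, hyk, hzk⟩ := exists_line_through (hskew hyl hzm)
    have hyk' := (mk_le_iff hy).1 hyk
    have hzk' := (mk_le_iff hz).1 hzk
    have huk' : e.symm ![α, β, α, β] = e.symm ![α, β, 0, 0] + e.symm ![0, 0, α, β] := by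
      rw [← map_add]; simp
    have hwk' : w.rep = s • e.symm ![α, β, 0, 0] + t • e.symm ![0, 0, α, β] := by
      rw [← map_smul, ← map_smul, ← map_add, LinearEquiv.eq_symm_apply]
      ext i
      fin_cases i
      · simpa using h0
      · simpa using h1
      · simpa using h2
      · simpa using h3
    refine ⟨k, rep_mem_iff.1 ?_, ⟨_, hyl, hyk⟩, ⟨_, hzm, hzk⟩, ⟨_, hun, (mk_le_iff hu).2 ?_⟩⟩
    · rw [hwk']
      exact add_mem (k.1.smul_mem _ hyk') (k.1.smul_mem _ hzk')
    · rw [huk']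
      exact add_mem hyk' hzk'
  · rintro ⟨k, hwk, ⟨x, hxl, hxk⟩, ⟨y, hym, hyk⟩, ⟨z, hzn, hzk⟩⟩ v hv
    have hk : ∀ v ∈ k.1, ∃ s t : K, s • x.rep + t • y.rep = v := by
      intro v hv
      rw [line_eq_sup (hskew hxl hym) hxk hyk, Projectivization.submodule_eq,
        Projectivization.submodule_eq, ← Submodule.span_union, Set.singleton_union,
        Submodule.mem_span_pair] at hv
      exact hv
    obtain ⟨s, t, hst⟩ := hk z.rep (rep_mem_iff.2 hzk)
    obtain ⟨s', t', rfl⟩ := hk v (hwk hv)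
    obtain ⟨x2, x3⟩ := (hl _).1 (rep_mem_iff.2 hxl)
    obtain ⟨y0, y1⟩ := (hm _).1 (rep_mem_iff.2 hym)
    obtain ⟨z0, z1⟩ := (hn _).1 (rep_mem_iff.2 hzn)
    rw [← hst] at z0 z1
    simp only [map_add, map_smul, Pi.add_apply, Pi.smul_apply, smul_eq_mul, x2, x3, y0, y1,
      mul_zero, add_zero, zero_add] at z0 z1
    have hs : s ≠ 0 := by
      rintro rfl
      refine z.rep_nonzero (Submodule.disjoint_def.1 hmn _ ?_ (rep_mem_iff.2 hzn))
      rw [← hst, zero_smul, zero_add]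
      exact m.1.smul_mem t (rep_mem_iff.2 hym)
    have ht : t ≠ 0 := by
      rintro rfl
      refine z.rep_nonzero (Submodule.disjoint_def.1 hln _ ?_ (rep_mem_iff.2 hzn))
      rw [← hst, zero_smul, add_zero]
      exact l.1.smul_mem s (rep_mem_iff.2 hxl)
    have hdet : e x.rep 0 * e y.rep 3 - e x.rep 1 * e y.rep 2 = 0 := by
      refine (mul_eq_zero.1 (?_ : (s * t) * (_ - _) = 0)).resolve_left (mul_ne_zero hs ht)
      linear_combination t * e y.rep 3 * z0 - t * e y.rep 2 * z1
    rw [detForm_apply]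
    simp only [map_add, map_smul, Pi.add_apply, Pi.smul_apply, smul_eq_mul, x2, x3, y0, y1,
      mul_zero, add_zero, zero_add]
    linear_combination s' * t' * hdet

end Quadric
/-! ### The black points form a hyperbolic quadric -/

section Hyperbolic

open Finset
open scoped Classical

variable {K : Type*} [Field K] [Fintype K] {S : Finset (Line K)} {q : ℕ}

namespace IsSecantFamily

/-- The tangent plane on a black line has its pole on that line. -/
theorem exists_pole_on (h : IsSecantFamily S q) {l : Line K} (hl : blackCard S l = q + 1)
    {π : Plane K} (hπ : LineInPlane l π) : ∃ p, IsPole S p π ∧ PointOnLine p l := by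
  obtain ⟨p, -, hp⟩ := h.exists_pole (h.tangent_of_blackCard_eq hl hπ)
  exact ⟨p, hp, not_not.1 fun hn => h.not_mem_of_blackCard_eq hl ((hp.inside l hπ).2 hn)⟩

/-- In a plane with black pole, all points of the line joining the pole to another black point are
black. -/
theorem exists_black_line_of_pole (h : IsSecantFamily S q) {p x : Point K} {π : Plane K}
    (hp : IsPole S p π) (hpB : Black S p) (hxB : Black S x) (hx : PointInPlane x π) (hne : p ≠ x) :
    ∃ l, PointOnLine p l ∧ PointOnLine x l ∧ blackCard S l = q + 1 := by
  obtain ⟨l, hpl, hxl⟩ := exists_line_through hne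
  have hlπ := lineInPlane_of_ne hne hpl hxl hp.mem hx
  have hlS : l ∉ S := fun hl => (hp.inside l hlπ).1 hl hpl
  exact ⟨l, hpl, hxl, h.blackCard_eq_of_two hlS hne hpl hxl hpB hxB⟩

/-- Two black lines that meet a third one in different points are skew: in a common plane, all
three would pass through its pole. -/
theorem disjoint_of_meet (h : IsSecantFamily S q) {l m n : Line K} (hl : blackCard S l = q + 1)
    (hm : blackCard S m = q + 1) (hn : blackCard S n = q + 1) (hml : m ≠ l) (hnl : n ≠ l)
    {x y : Point K} (hxl : PointOnLine x l) (hxm : PointOnLine x m) (hyl : PointOnLine y l)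
    (hyn : PointOnLine y n) (hxy : x ≠ y) : Disjoint m.1 n.1 := by
  refine disjoint_of_no_common_point fun z hzm hzn => ?_
  have hzy : z ≠ y := by
    rintro rfl
    exact hml (line_unique hxy hxm hzm hxl hyl)
  obtain ⟨π, hπ⟩ := exists_join hml hxm hxl
  have hmπ : LineInPlane m π := le_sup_left.trans hπ.ge
  have hlπ : LineInPlane l π := le_sup_right.trans hπ.ge
  have hnπ := lineInPlane_of_ne hzy hzn hyn (hzm.inPlane hmπ) (hyl.inPlane hlπ)
  obtain ⟨p, hp, hpl⟩ := h.exists_pole_on hl hlπ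
  obtain ⟨p', hp', hpm⟩ := h.exists_pole_on hm hmπ
  obtain ⟨p'', hp'', hpn⟩ := h.exists_pole_on hn hnπ
  rw [← hp.point_unique hp'] at hpm
  rw [← hp.point_unique hp''] at hpn
  have h1 : p = x := by
    by_contra hne
    exact hml (line_unique hne hpm hxm hpl hxl)
  have h2 : p = y := by
    by_contra hne
    exact hnl (line_unique hne hpn hyn hpl hyl)
  exact hxy (h1.symm.trans h2)

theorem exists_other_black_line
    (hm : ∀ x : Point K, Black S x →
      #{l : Line K | PointOnLine x l ∧ blackCard S l = q + 1} = 2)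
    {x : Point K} (hx : Black S x) (l : Line K) :
    ∃ m, m ≠ l ∧ PointOnLine x m ∧ blackCard S m = q + 1 := by
  obtain ⟨m, hm', hne⟩ := Finset.exists_mem_ne (by rw [hm x hx]; exact Nat.one_lt_two) l
  exact ⟨m, hne, (mem_filter.1 hm').2.1, (mem_filter.1 hm').2.2⟩

theorem black_line_unique
    (hm : ∀ x : Point K, Black S x →
      #{l : Line K | PointOnLine x l ∧ blackCard S l = q + 1} = 2)
    {x : Point K} (hx : Black S x) {l m n : Line K} (hl : blackCard S l = q + 1)
    (hm' : blackCard S m = q + 1) (hn : blackCard S n = q + 1) (hxl : PointOnLine x l)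
    (hxm : PointOnLine x m) (hxn : PointOnLine x n) (hml : m ≠ l) (hnl : n ≠ l) : m = n := by
  by_contra hmn
  have h3 : #({l, m, n} : Finset (Line K)) = 3 :=
    Finset.card_eq_three.2 ⟨l, m, n, hml.symm, hnl.symm, hmn, rfl⟩
  have h4 := Finset.card_le_card (s := {l, m, n})
    (t := ({k | PointOnLine x k ∧ blackCard S k = q + 1} : Finset (Line K))) (by
      intro k hk
      simp only [mem_insert, mem_singleton] at hk
      rcases hk with rfl | rfl | rfl <;> simp [*])
  rw [h3, hm x hx] at h4
  omega

/-- If `l` and `m` are skew black lines and `k` is the second black line through a point of `l`,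
then `k` meets `m`: the polar plane of the point meets `m` in a black point, which lies on a black
line through the pole. -/
theorem exists_meet_of_skew (h : IsSecantFamily S q)
    (hm : ∀ x : Point K, Black S x →
      #{l : Line K | PointOnLine x l ∧ blackCard S l = q + 1} = 2)
    {l m k : Line K} (hl : blackCard S l = q + 1) (hm' : blackCard S m = q + 1)
    (hk : blackCard S k = q + 1) (hlm : Disjoint l.1 m.1) {x : Point K} (hxl : PointOnLine x l)
    (hxk : PointOnLine x k) (hkl : k ≠ l) : ∃ y, PointOnLine y m ∧ PointOnLine y k := by
  have hskew : ∀ y, PointOnLine y l → ¬ PointOnLine y m := fun y hyl hym =>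
    y.rep_nonzero (Submodule.disjoint_def.1 hlm _ (rep_mem_iff.2 hyl) (rep_mem_iff.2 hym))
  have hx := h.black_of_blackCard_eq hl hxl
  obtain ⟨π, hπ, hp⟩ := h.exists_polar hx
  obtain ⟨y, hym, hyπ⟩ := exists_meet_plane m π
  have hxy : x ≠ y := by
    rintro rfl
    exact hskew x hxl hym
  obtain ⟨n, hxn, hyn, hn⟩ :=
    h.exists_black_line_of_pole hp hx (h.black_of_blackCard_eq hm' hym) hyπ hxy
  have hnl : n ≠ l := by
    rintro rfl
    exact hskew y hyn hym
  have := black_line_unique hm hx hl hk hn hxl hxk hxn hkl hnl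
  exact ⟨y, hym, this ▸ hyn⟩

/-- If every black point is on exactly two black lines, the black points are those of a hyperbolic
quadric, namely the one determined by three black lines meeting a fourth. -/
theorem exists_hyperbolic (h : IsSecantFamily S q)
    (hm : ∀ x : Point K, Black S x →
      #{l : Line K | PointOnLine x l ∧ blackCard S l = q + 1} = 2) :
    ∃ Q : QuadraticForm K (Vec K), IsHyperbolic Q ∧ ∀ x, x ∈ quadricPoints Q ↔ Black S x := by
  obtain ⟨b, hb⟩ := h.exists_black
  have hbB : Black S b := by rw [Black, h.card_field]; exact hb
  obtain ⟨g, hg⟩ := Finset.card_pos.1 ((hm b hbB).ge.trans_lt' Nat.zero_lt_two)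
  replace hg := (mem_filter.1 hg).2.2
  have hcard : 2 < #{x : Point K | PointOnLine x g} := by
    rw [card_points_on, h.card_field]
    have := h.three_le
    omega
  obtain ⟨x, y, z, hx, hy, hz, hxy, hxz, hyz⟩ := Finset.two_lt_card_iff.1 hcard
  simp only [mem_filter, mem_univ, true_and] at hx hy hz
  obtain ⟨l, hlg, hxl, hl⟩ := exists_other_black_line hm (h.black_of_blackCard_eq hg hx) g
  obtain ⟨m, hmg, hym, hm'⟩ := exists_other_black_line hm (h.black_of_blackCard_eq hg hy) g
  obtain ⟨n, hng, hzn, hn⟩ := exists_other_black_line hm (h.black_of_blackCard_eq hg hz) g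
  have hlm := h.disjoint_of_meet hg hl hm' hlg hmg hx hxl hy hym hxy
  have hln := h.disjoint_of_meet hg hl hn hlg hng hx hxl hz hzn hxz
  have hmn := h.disjoint_of_meet hg hm' hn hmg hng hy hym hz hzn hyz
  obtain ⟨Q, hQ, hQ'⟩ := exists_hyperbolic_of_skew hlm hln hmn
  refine ⟨Q, hQ, fun w => (hQ' w).trans ⟨?_, fun hw => ?_⟩⟩
  · rintro ⟨k, hwk, ⟨a, hal, hak⟩, ⟨b, hbm, hbk⟩, ⟨c, hcn, hck⟩⟩
    have hne : ∀ {r s : Line K}, Disjoint r.1 s.1 → ∀ {u v : Point K}, PointOnLine u r →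
        PointOnLine v s → u ≠ v := by
      rintro r s hrs u _ hu hv rfl
      exact u.rep_nonzero (Submodule.disjoint_def.1 hrs _ (rep_mem_iff.2 hu) (rep_mem_iff.2 hv))
    refine h.black_of_blackCard_eq ((h.blackCard_cases k).resolve_right fun hc => ?_) hwk
    have h3 : 2 < blackCard S k := Finset.two_lt_card_iff.2 ⟨a, b, c,
      by simp [hak, h.black_of_blackCard_eq hl hal], by simp [hbk, h.black_of_blackCard_eq hm' hbm],
      by simp [hck, h.black_of_blackCard_eq hn hcn], hne hlm hal hbm, hne hln hal hcn,
      hne hmn hbm hcn⟩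
    omega
  · obtain ⟨k, a, hkl, hwk, hal, hak, hk⟩ : ∃ k a, k ≠ l ∧ PointOnLine w k ∧ PointOnLine a l ∧
        PointOnLine a k ∧ blackCard S k = q + 1 := by
      by_cases hwl : PointOnLine w l
      · obtain ⟨k, hkl, hwk, hk⟩ := exists_other_black_line hm hw l
        exact ⟨k, w, hkl, hwk, hwl, hwk, hk⟩
      · obtain ⟨π, hwπ, hlπ⟩ := exists_plane hwl
        obtain ⟨p, hp, hpl⟩ := h.exists_pole_on hl hlπ
        have hpw : p ≠ w := by
          rintro rfl
          exact hwl hpl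
        obtain ⟨k, hpk, hwk, hk⟩ :=
          h.exists_black_line_of_pole hp (h.black_of_blackCard_eq hl hpl) hw hwπ hpw
        refine ⟨k, p, ?_, hwk, hpl, hpk, hk⟩
        rintro rfl
        exact hwl hwk
    exact ⟨k, hwk, ⟨a, hal, hak⟩, h.exists_meet_of_skew hm hl hm' hk hlm hal hak hkl,
      h.exists_meet_of_skew hm hl hn hk hln hal hak hkl⟩

end IsSecantFamily

end Hyperbolic

/-! ### Translation of the hypotheses -/

section Translation

open scoped Classical

variable {K : Type*} [Field K] [Fintype K]

theorem ncard_inter_eq {S : Set (Line K)} {T : Set (Line K)} {p : Line K → Prop} [DecidablePred p]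
    (hT : ∀ l, l ∈ T ↔ p l) : (S ∩ T).ncard = (S.toFinset.filter p).card := by
  rw [← Set.ncard_coe_finset]
  congr 1
  ext l
  simp [hT]

theorem ncard_linesThrough (S : Set (Line K)) (x : Point K) :
    (S ∩ linesThrough x).ncard = (S.toFinset.filter (PointOnLine x ·)).card :=
  ncard_inter_eq fun _ => Iff.rfl

theorem ncard_linesIn (S : Set (Line K)) (π : Plane K) :
    (S ∩ linesIn π).ncard = (S.toFinset.filter (LineInPlane · π)).card :=
  ncard_inter_eq fun _ => Iff.rfl

theorem ncard_pencil (S : Set (Line K)) (x : Point K) (π : Plane K) :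
    (S ∩ pencil x π).ncard
      = (S.toFinset.filter fun l => PointOnLine x l ∧ LineInPlane l π).card :=
  ncard_inter_eq fun _ => Iff.rfl

theorem two_mul_eq_of_eq_half {n q : ℕ} : n = q * (q + 1) / 2 ↔ 2 * n = q * (q + 1) := by
  obtain ⟨r, hr⟩ := Nat.even_mul_succ_self q
  rw [hr]
  omega

theorem isSecantFamily_toFinset {q : ℕ} (hq : Fintype.card K = q) (hodd : Odd q) (S : Set (Line K))
    (P1 : ∀ x : Point K,
      (S ∩ linesThrough x).ncard = q * (q + 1) / 2 ∨ (S ∩ linesThrough x).ncard = q ^ 2)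
    (P1a : ∃ x : Point K, (S ∩ linesThrough x).ncard = q * (q + 1) / 2)
    (P1b : ∃ x : Point K, (S ∩ linesThrough x).ncard = q ^ 2)
    (P2 : ∀ π : Plane K,
      (S ∩ linesIn π).ncard = q * (q + 1) / 2 ∨ (S ∩ linesIn π).ncard = q ^ 2)
    (P2a : ∀ π : Plane K, (S ∩ linesIn π).ncard = q ^ 2 → ∀ x : Point K, PointInPlane x π →
      (S ∩ pencil x π).ncard = 0 ∨ (S ∩ pencil x π).ncard = q)
    (P2b : ∀ π : Plane K, (S ∩ linesIn π).ncard = q * (q + 1) / 2 →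
      ∀ x : Point K, PointInPlane x π →
        (S ∩ pencil x π).ncard = (q - 1) / 2 ∨ (S ∩ pencil x π).ncard = (q + 1) / 2 ∨
          (S ∩ pencil x π).ncard = q) :
    IsSecantFamily S.toFinset q := by
  simp only [ncard_linesThrough, ncard_linesIn, ncard_pencil, two_mul_eq_of_eq_half]
    at P1 P1a P1b P2 P2a P2b
  have h1 : 1 < q := hq ▸ Fintype.one_lt_card
  obtain ⟨r, hr⟩ := hodd
  refine ⟨hq, by omega, P1, P1a, P1b, P2, P2a, fun π hπ x hx => ?_⟩
  have := P2b π hπ x hx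
  omega

end Translation

end PG3

theorem theorem1 {K : Type*} [Field K] [Fintype K] (q : ℕ) (hq : Fintype.card K = q)
    (hodd : Odd q) (S : Set (PG3.Line K))
    (P1 : ∀ x : PG3.Point K,
      (S ∩ PG3.linesThrough x).ncard = q * (q + 1) / 2 ∨ (S ∩ PG3.linesThrough x).ncard = q ^ 2)
    (P1a : ∃ x : PG3.Point K, (S ∩ PG3.linesThrough x).ncard = q * (q + 1) / 2)
    (P1b : ∃ x : PG3.Point K, (S ∩ PG3.linesThrough x).ncard = q ^ 2)
    (P2 : ∀ π : PG3.Plane K,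
      (S ∩ PG3.linesIn π).ncard = q * (q + 1) / 2 ∨ (S ∩ PG3.linesIn π).ncard = q ^ 2)
    (P2a : ∀ π : PG3.Plane K, (S ∩ PG3.linesIn π).ncard = q ^ 2 →
      ∀ x : PG3.Point K, PG3.PointInPlane x π →
        (S ∩ PG3.pencil x π).ncard = 0 ∨ (S ∩ PG3.pencil x π).ncard = q)
    (P2b : ∀ π : PG3.Plane K, (S ∩ PG3.linesIn π).ncard = q * (q + 1) / 2 →
      ∀ x : PG3.Point K, PG3.PointInPlane x π →
        (S ∩ PG3.pencil x π).ncard = (q - 1) / 2 ∨ (S ∩ PG3.pencil x π).ncard = (q + 1) / 2 ∨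
          (S ∩ PG3.pencil x π).ncard = q) :
    (∃ Q : QuadraticForm K (PG3.Vec K), PG3.IsHyperbolic Q ∧
      S = PG3.secantLines (PG3.quadricPoints Q)) ∨
    (∃ l : PG3.Line K,
      {x : PG3.Point K | (S ∩ PG3.linesThrough x).ncard = q ^ 2} =
        {x : PG3.Point K | PG3.PointOnLine x l} ∧
      l ∉ S ∧ S.ncard = (q ^ 4 + q ^ 3 + 2 * q ^ 2) / 2) := by
  classical
  have h := PG3.isSecantFamily_toFinset hq hodd S P1 P1a P1b P2 P2a P2b
  rcases h.card_black_cases with ⟨hB, l, hl⟩ | ⟨hB, hm⟩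
  · right
    obtain ⟨h1, h2, h3⟩ := h.exists_line_of_card_black hB hl
    refine ⟨l, ?_, by simpa using h2, ?_⟩
    · ext x
      rw [Set.mem_ofPred_eq, Set.mem_ofPred_eq, ← h1, PG3.Black, PG3.ncard_linesThrough, hq]
    · rw [Set.ncard_eq_toFinset_card']
      omega
  · left
    obtain ⟨Q, hQ, hQ'⟩ := h.exists_hyperbolic hm
    refine ⟨Q, hQ, ?_⟩
    ext l
    have h1 := h.mem_iff_blackCard_eq_two hB l
    rw [Set.mem_toFinset] at h1
    rw [h1, PG3.blackCard, PG3.secantLines, Set.mem_ofPred_eq, ← Set.ncard_coe_finset]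
    have h2 : {x : PG3.Point K | x ∈ PG3.quadricPoints Q ∧ PG3.PointOnLine x l}
        = ((Finset.univ.filter fun x : PG3.Point K =>
            PG3.PointOnLine x l ∧ PG3.Black S.toFinset x : Finset (PG3.Point K)) :
          Set (PG3.Point K)) := by
      ext x
      simp [hQ', and_comm]
    rw [h2]
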